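/- Let $k$ be a commutative ring and let $d,m,n\ge 0$ be integers. For a $k$-module $U$ put $\Gamma^dU=(U^{\otimes d})^{\mathfrak S_d}$. Let $\Gamma^d\mathsf P_k$ be the $k$-linear category whose objects are the finitely generated projective $k$-modules and whose morphisms are $\operatorname{Hom}_{\Gamma^d\mathsf P_k}(V,W)=\Gamma^d\operatorname{Hom}_k(V,W)$, with composition induced by that of linear maps. Let $\operatorname{Rep}\Gamma^d_k$ be the category of $k$-linear functors from $\Gamma^d\mathsf P_k$ to $k$-modules (strict polynomial functors of degree $d$), and write $\Gamma^{d,V}=\operatorname{Hom}_{\Gamma^d\mathsf P_k}(V,-)$. *Internal tensor product.* The tensor product of modules makes $(V,W)\mapsto V\otimes_kW$ a bifunctor on $\Gamma^d\mathsf P_k$, and one sets $$\Gamma^{d,V}\otimes_{\Gamma^d_k}\Gamma^{d,W}=\Gamma^{d,V\otimes_k W},\qquad \Gamma^{d,V}\otimes_{\Gamma^d_k}Y=\operatorname{colim}_{\Gamma^{d,W}\to Y}\Gamma^{d,V\otimes_k W},\qquad X\otimes_{\Gamma^d_k}Y=\operatorname{colim}_{\Gamma^{d,V}\to X}\bigl(\Gamma^{d,V}\otimes_{\Gamma^d_k}Y\bigr)$$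 for $X,Y\in\operatorname{Rep}\Gamma^d_k$, the colimits being taken over the categories of representable functors over $Y$ and over $X$, respectively. *The functors $\Gamma^\lambda$.* A composition of $d$ in $n$ parts is a tuple $\lambda=(\lambda_1,\dots,\lambda_n)$ of nonnegative integers with $\sum_i\lambda_i=d$. For such $\lambda$ let $\Gamma^\lambda=\Gamma^{\lambda_1,k}\otimes\cdots\otimes\Gamma^{\lambda_n,k}\in\operatorname{Rep}\Gamma^d_k$ be the external tensor product: $\Gamma^\lambda(V)=\Gamma^{\lambda_1,k}(V)\otimes_k\cdots\otimes_k\Gamma^{\lambda_n,k}(V)$, with the action on morphisms through the comultiplication $\Gamma^d\operatorname{Hom}_k(V,W)\to\Gamma^{\lambda_1}\operatorname{Hom}_k(V,W)\otimes_k\cdots\otimes_k\Gamma^{\lambda_n}\operatorname{Hom}_k(V,W)$. **Corollary.** Let $\lambda$ be a composition of $d$ in $m$ parts and $\mu$ a composition of $d$ in $n$ parts. Let $A^\lambda_\mu$ be the set of all $m\times n$ matrices $A=(a_{ij})$ of nonnegative integers with $\sum_ja_{ij}=\lambda_i$ for all $i$ and $\sum_ia_{ij}=\mu_j$ for all $j$.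 Then there is an isomorphism in $\operatorname{Rep}\Gamma^d_k$ $$\Gamma^\lambda\otimes_{\Gamma^d_k}\Gamma^\mu\;\cong\;\bigoplus_{A\in A^\lambda_\mu}\Gamma^A ,$$ where $A$ is regarded as the composition $(a_{11},a_{12},\dots,a_{1n},a_{21},\dots,a_{mn})$ of $d$ in $mn$ parts. -/

import Mathlib

open CategoryTheory CategoryTheory.Limits Opposite
open scoped TensorProduct

universe u

noncomputable section

namespace StrictPolynomial

section SymmetricTensors

variable {k : Type u} [CommRing k] {U V W : Type u}
  [AddCommGroup U] [Module k U] [AddCommGroup V] [Module k V] [AddCommGroup W] [Module k W]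

/-- Permutation of the tensor factors of `U^{⊗ d}`. -/
abbrev permute (k : Type u) [CommRing k] (U : Type u) [AddCommGroup U] [Module k U] {d : ℕ}
    (σ : Equiv.Perm (Fin d)) : (⨂[k] (_ : Fin d), U) →ₗ[k] (⨂[k] (_ : Fin d), U) :=
  (PiTensorProduct.reindex k (fun _ : Fin d => U) σ).toLinearMap

/-- The module `Γ^d U` of symmetric tensors: the `𝔖_d`-invariant part of `U^{⊗ d}`. -/
def SymTensor (k : Type u) [CommRing k] (d : ℕ) (U : Type u) [AddCommGroup U] [Module k U] :
    Submodule k (⨂[k] (_ : Fin d), U) where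
  carrier := {x | ∀ σ : Equiv.Perm (Fin d), permute k U σ x = x}
  add_mem' := by
    intro a b ha hb σ
    rw [map_add, ha σ, hb σ]
  zero_mem' := by
    intro σ
    rw [map_zero]
  smul_mem' := by
    intro c x hx σ
    rw [map_smul, hx σ]

theorem permute_map₂ {d : ℕ} (β : U →ₗ[k] V →ₗ[k] W) (σ : Equiv.Perm (Fin d))
    (x : ⨂[k] (_ : Fin d), U) (y : ⨂[k] (_ : Fin d), V) :
    permute k W σ (PiTensorProduct.map₂ (fun _ => β) x y) =
      PiTensorProduct.map₂ (fun _ => β) (permute k U σ x) (permute k V σ y) := by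
  induction x using PiTensorProduct.induction_on with
  | smul_tprod r f =>
    induction y using PiTensorProduct.induction_on with
    | smul_tprod s g =>
      simp only [permute, map_smul, LinearMap.smul_apply, LinearEquiv.coe_coe,
        PiTensorProduct.map₂_tprod_tprod, PiTensorProduct.reindex_tprod]
    | add y y' hy hy' => simp only [map_add, hy, hy']
  | add x x' hx hx' => simp only [map_add, LinearMap.add_apply, hx, hx']

theorem permute_map {d : ℕ} (f : U →ₗ[k] V) (σ : Equiv.Perm (Fin d))
    (x : ⨂[k] (_ : Fin d), U) :
    permute k V σ (PiTensorProduct.map (fun _ => f) x) =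
      PiTensorProduct.map (fun _ => f) (permute k U σ x) := by
  induction x using PiTensorProduct.induction_on with
  | smul_tprod r f =>
    simp only [permute, map_smul, LinearEquiv.coe_coe,
        PiTensorProduct.map_tprod, PiTensorProduct.reindex_tprod]
  | add x x' hx hx' => simp only [map_add, hx, hx']

/-- The map `Γ^d U → Γ^d V` induced by a linear map `U → V`. -/
def SymTensor.map (d : ℕ) (f : U →ₗ[k] V) : SymTensor k d U →ₗ[k] SymTensor k d V :=
  (PiTensorProduct.map (fun _ : Fin d => f)).restrict
    (fun x hx σ => by rw [permute_map, hx σ])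

/-- The bilinear map `Γ^d U × Γ^d V → Γ^d W` induced by a bilinear map `β : U × V → W`,
that is, `Γ^d U × Γ^d V → Γ^d (U ⊗ V) → Γ^d W`. -/
def SymTensor.map₂ (d : ℕ) (β : U →ₗ[k] V →ₗ[k] W) : SymTensor k d U →ₗ[k] SymTensor k d V →ₗ[k] SymTensor k d W :=
  LinearMap.mk₂ k
    (fun x y => ⟨PiTensorProduct.map₂ (fun _ => β) x.1 y.1,
      fun σ => by rw [permute_map₂, x.2 σ, y.2 σ]⟩)
    (fun x x' y => Subtype.ext (by simp))
    (fun c x y => Subtype.ext (by simp))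
    (fun x y y' => Subtype.ext (by simp))
    (fun c x y => Subtype.ext (by simp))

theorem SymTensor.map₂_val {d : ℕ} (β : U →ₗ[k] V →ₗ[k] W) (x : SymTensor k d U) (y : SymTensor k d V) :
    (SymTensor.map₂ d β x y).1 = PiTensorProduct.map₂ (fun _ => β) x.1 y.1 := rfl

/-- The symmetric tensor `u ⊗ ⋯ ⊗ u`. -/
def SymTensor.pow (d : ℕ) (u : U) : SymTensor k d U :=
  ⟨⨂ₜ[k] _, u, fun σ => by simp [permute]⟩

/-! ### The comultiplication `Γ^d U → Γ^{λ₁} U ⊗ ⋯ ⊗ Γ^{λₙ} U` -/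

/-- For `d = λ₁ + ⋯ + λₙ`, the identification of `Fin d` with the disjoint union of consecutive
blocks of lengths `λ₁, …, λₙ`. -/
def blocks {n d : ℕ} (l : Fin n → ℕ) (h : ∑ i, l i = d) : (Σ i, Fin (l i)) ≃ Fin d :=
  finSigmaFinEquiv.trans (finCongr h)

/-- The map `U^{⊗ d} → U^{⊗ λ₁} ⊗ ⋯ ⊗ U^{⊗ λₙ}` for `d = λ₁ + ⋯ + λₙ` which brackets the tensor
factors into consecutive blocks. -/
def bracket (k : Type u) [CommRing k] (U : Type u) [AddCommGroup U] [Module k U]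
    {n d : ℕ} (l : Fin n → ℕ) (h : ∑ i, l i = d) :
    (⨂[k] (_ : Fin d), U) →ₗ[k] ⨂[k] i : Fin n, ⨂[k] (_ : Fin (l i)), U :=
  PiTensorProduct.lift
    { toFun := fun u => ⨂ₜ[k] i, ⨂ₜ[k] j, u (blocks l h ⟨i, j⟩)
      map_update_add' := by
        intro _ u p x y
        obtain ⟨⟨i, j⟩, rfl⟩ := (blocks l h).surjective p
        have key : ∀ z : U, (fun i' => ⨂ₜ[k] j', Function.update u (blocks l h ⟨i, j⟩) z
              (blocks l h ⟨i', j'⟩)) =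
            Function.update (fun i' => ⨂ₜ[k] j', u (blocks l h ⟨i', j'⟩)) i
              (⨂ₜ[k] j', Function.update (fun j' => u (blocks l h ⟨i, j'⟩)) j z j') := by
          intro z
          funext i'
          by_cases hi : i' = i
          · subst hi
            rw [Function.update_self]
            congr 1
            funext j'
            by_cases hj : j' = j
            · subst hj; simp
            · rw [Function.update_of_ne hj, Function.update_of_ne]
              simpa using hj
          · rw [Function.update_of_ne hi]
            congr 1
            funext j'
            rw [Function.update_of_ne]
            intro hc
            exact hi (congrArg Sigma.fst ((blocks l h).injective hc))
        have e : ∀ (v : Fin (l i) → U), (⨂ₜ[k] j', v j') = PiTensorProduct.tprod k v := fun _ => rfl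
        rw [key, key, key, e, e, e, MultilinearMap.map_update_add, MultilinearMap.map_update_add]
      map_update_smul' := by
        intro _ u p c x
        obtain ⟨⟨i, j⟩, rfl⟩ := (blocks l h).surjective p
        have key : ∀ z : U, (fun i' => ⨂ₜ[k] j', Function.update u (blocks l h ⟨i, j⟩) z
              (blocks l h ⟨i', j'⟩)) =
            Function.update (fun i' => ⨂ₜ[k] j', u (blocks l h ⟨i', j'⟩)) i
              (⨂ₜ[k] j', Function.update (fun j' => u (blocks l h ⟨i, j'⟩)) j z j') := by
          intro z
          funext i'
          by_cases hi : i' = i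
          · subst hi
            rw [Function.update_self]
            congr 1
            funext j'
            by_cases hj : j' = j
            · subst hj; simp
            · rw [Function.update_of_ne hj, Function.update_of_ne]
              simpa using hj
          · rw [Function.update_of_ne hi]
            congr 1
            funext j'
            rw [Function.update_of_ne]
            intro hc
            exact hi (congrArg Sigma.fst ((blocks l h).injective hc))
        have e : ∀ (v : Fin (l i) → U), (⨂ₜ[k] j', v j') = PiTensorProduct.tprod k v := fun _ => rfl
        rw [key, key, e, e, MultilinearMap.map_update_smul, MultilinearMap.map_update_smul] }

theorem bracket_tprod {n d : ℕ} (l : Fin n → ℕ) (h : ∑ i, l i = d) (u : Fin d → U) :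
    bracket k U l h (⨂ₜ[k] p, u p) = ⨂ₜ[k] i, ⨂ₜ[k] j, u (blocks l h ⟨i, j⟩) :=
  PiTensorProduct.lift.tprod _

theorem bracket_map {n d : ℕ} (l : Fin n → ℕ) (h : ∑ i, l i = d) (f : U →ₗ[k] V)
    (x : ⨂[k] (_ : Fin d), U) :
    bracket k V l h (PiTensorProduct.map (fun _ => f) x) =
      PiTensorProduct.map (fun i => PiTensorProduct.map (fun _ : Fin (l i) => f))
        (bracket k U l h x) := by
  induction x using PiTensorProduct.induction_on with
  | smul_tprod r u =>
    simp only [map_smul, PiTensorProduct.map_tprod, bracket_tprod]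
  | add x x' hx hx' => simp only [map_add, hx, hx']

theorem bracket_map₂ {n d : ℕ} (l : Fin n → ℕ) (h : ∑ i, l i = d) (β : U →ₗ[k] V →ₗ[k] W)
    (x : ⨂[k] (_ : Fin d), U) (y : ⨂[k] (_ : Fin d), V) :
    bracket k W l h (PiTensorProduct.map₂ (fun _ => β) x y) =
      PiTensorProduct.map₂ (fun i => PiTensorProduct.map₂ (fun _ : Fin (l i) => β))
        (bracket k U l h x) (bracket k V l h y) := by
  induction x using PiTensorProduct.induction_on with
  | smul_tprod r u =>
    induction y using PiTensorProduct.induction_on with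
    | smul_tprod s v =>
      simp only [map_smul, LinearMap.smul_apply, PiTensorProduct.map₂_tprod_tprod, bracket_tprod]
    | add y y' hy hy' => simp only [map_add, hy, hy']
  | add x x' hx hx' => simp only [map_add, LinearMap.add_apply, hx, hx']

/-- The inclusion `Γ^{λ₁} U ⊗ ⋯ ⊗ Γ^{λₙ} U → U^{⊗ λ₁} ⊗ ⋯ ⊗ U^{⊗ λₙ}`. -/
def inclSym (k : Type u) [CommRing k] (U : Type u) [AddCommGroup U] [Module k U]
    {n : ℕ} (l : Fin n → ℕ) :
    (⨂[k] i : Fin n, SymTensor k (l i) U) →ₗ[k] ⨂[k] i : Fin n, ⨂[k] (_ : Fin (l i)), U :=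
  PiTensorProduct.map (fun i => (SymTensor k (l i) U).subtype)

/-- The coordinate of a tensor in `(k^m)^{⊗ d}` at the basis vector `e_{j₁} ⊗ ⋯ ⊗ e_{j_d}`. -/
def coord (k : Type u) [CommRing k] (m : ℕ) {d : ℕ} (j : Fin d → Fin m) :
    (⨂[k] (_ : Fin d), (Fin m → k)) →ₗ[k] k :=
  (Basis.piTensorProduct (fun _ : Fin d => Pi.basisFun k (Fin m))).coord j

theorem coord_tprod {m d : ℕ} (j : Fin d → Fin m) (v : Fin d → Fin m → k) :
    coord k m j (⨂ₜ[k] p, v p) = ∏ p, v p (j p) := by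
  simp [coord]

theorem coord_permute {m d : ℕ} (j : Fin d → Fin m) (σ : Equiv.Perm (Fin d))
    (x : ⨂[k] (_ : Fin d), (Fin m → k)) :
    coord k m j (permute k _ σ x) = coord k m (j ∘ σ) x := by
  induction x using PiTensorProduct.induction_on with
  | smul_tprod r v =>
    simp only [permute, map_smul, LinearEquiv.coe_coe, PiTensorProduct.reindex_tprod, coord_tprod]
    congr 1
    rw [← Equiv.prod_comp σ]
    simp
  | add x x' hx hx' => simp only [map_add, hx, hx']

theorem coord_ext {m d : ℕ} {x y : ⨂[k] (_ : Fin d), (Fin m → k)}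
    (h : ∀ j, coord k m j x = coord k m j y) : x = y :=
  (Basis.piTensorProduct (fun _ : Fin d => Pi.basisFun k (Fin m))).ext_elem h

theorem exists_coord {m d : ℕ} (c : (Fin d → Fin m) → k) :
    ∃ x, ∀ j, coord k m j x = c j :=
  ⟨(Basis.piTensorProduct
    (fun _ : Fin d => Pi.basisFun k (Fin m))).equivFun.symm c, fun j => by
      have := congrFun ((Basis.piTensorProduct
        (fun _ : Fin d => Pi.basisFun k (Fin m))).equivFun.apply_symm_apply c) j
      simpa [coord] using this⟩

set_option synthInstance.maxHeartbeats 200000 in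
theorem exists_retraction_free (k : Type u) [CommRing k] (m : ℕ) :
    ∃ r : ∀ d : ℕ, (⨂[k] (_ : Fin d), (Fin m → k)) →ₗ[k] SymTensor k d (Fin m → k),
      (∀ d, ∀ x : SymTensor k d (Fin m → k), r d x.1 = x) ∧
      ∀ {n d : ℕ} (l : Fin n → ℕ) (h : ∑ i, l i = d) (x : SymTensor k d (Fin m → k)),
        inclSym k (Fin m → k) l (PiTensorProduct.map (fun i => r (l i)) (bracket k _ l h x.1)) =
          bracket k _ l h x.1 := by
  classical
  -- a choice of representatives of the orbits of multi-indices
  have hs : ∀ d : ℕ, ∃ s : (Fin d → Fin m) → (Fin d → Fin m),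
      (∀ j, ∃ σ : Equiv.Perm (Fin d), s j = j ∘ σ) ∧
      ∀ (j) (σ : Equiv.Perm (Fin d)), s (j ∘ σ) = s j := by
    intro d
    let S : Setoid (Fin d → Fin m) :=
      { r := fun a b => ∃ σ : Equiv.Perm (Fin d), b = a ∘ σ
        iseqv :=
          { refl := fun a => ⟨1, rfl⟩
            symm := by
              rintro a b ⟨σ, rfl⟩
              exact ⟨σ⁻¹, by funext p; simp⟩
            trans := by
              rintro a b c ⟨σ, rfl⟩ ⟨τ, rfl⟩
              exact ⟨σ * τ, rfl⟩ } }
    refine ⟨fun j => (Quotient.mk S j).out, fun j => ?_, fun j σ => ?_⟩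
    · exact Setoid.symm (Quotient.mk_out (s := S) j)
    · have : Quotient.mk S (j ∘ σ) = Quotient.mk S j :=
        Quotient.sound (Setoid.symm (⟨σ, rfl⟩ : S.r j (j ∘ σ)))
      simp only [this]
  choose s hs₁ hs₂ using hs
  have hE : ∀ d : ℕ, ∃ r : (⨂[k] (_ : Fin d), (Fin m → k)) →ₗ[k] SymTensor k d (Fin m → k),
      ∀ x j, coord k m j (r x).1 = coord k m (s d j) x := by
    intro d
    choose f hf using fun x : ⨂[k] (_ : Fin d), (Fin m → k) =>
      exists_coord (k := k) (fun j => coord k m (s d j) x)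
    exact ⟨{ toFun := fun x => ⟨f x, fun σ => coord_ext fun j => by
                rw [coord_permute, hf, hf, hs₂]⟩
             map_add' := fun x y => Subtype.ext (coord_ext fun j => by simp [hf])
             map_smul' := fun c x => Subtype.ext (coord_ext fun j => by simp [hf]) }, hf⟩
  choose r hr using hE
  have hinv : ∀ {d : ℕ} (x : SymTensor k d (Fin m → k)) (j) (σ : Equiv.Perm (Fin d)),
      coord k m (j ∘ σ) x.1 = coord k m j x.1 := by
    intro d x j σ
    rw [← coord_permute, x.2 σ]
  refine ⟨r, fun d x => Subtype.ext (coord_ext fun j => ?_), ?_⟩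
  · obtain ⟨σ, hσ⟩ := hs₁ d j
    rw [hr, hσ, hinv]
  · intro n d l h x
    let B := Basis.piTensorProduct (fun i : Fin n =>
      Basis.piTensorProduct (fun _ : Fin (l i) => Pi.basisFun k (Fin m)))
    let flat : (∀ i, Fin (l i) → Fin m) → (Fin d → Fin m) :=
      fun J p => J ((blocks l h).symm p).1 ((blocks l h).symm p).2
    have hflat : ∀ J q, flat J (blocks l h q) = J q.1 q.2 := by
      intro J q
      exact congrArg (fun q : Σ i, Fin (l i) => J q.1 q.2) ((blocks l h).symm_apply_apply q)
    have h₁ : ∀ J y, B.coord J (bracket k _ l h y) = coord k m (flat J) y := by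
      intro J y
      induction y using PiTensorProduct.induction_on with
      | smul_tprod c v =>
        simp only [map_smul, bracket_tprod, coord_tprod]
        congr 1
        simp only [B, Module.Basis.coord_apply,
          Basis.piTensorProduct_repr_tprod_apply, Pi.basisFun_repr]
        rw [← (blocks l h).prod_comp, Fintype.prod_sigma]
        simp only [hflat]
      | add y y' hy hy' => simp only [map_add, hy, hy']
    have h₂ : ∀ J z, B.coord J (inclSym k (Fin m → k) l
        (PiTensorProduct.map (fun i => r (l i)) z)) = B.coord (fun i => s (l i) (J i)) z := by
      intro J z
      induction z using PiTensorProduct.induction_on with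
      | smul_tprod c v =>
        simp only [map_smul, inclSym, PiTensorProduct.map_tprod]
        congr 1
        simp only [B, Module.Basis.coord_apply,
          Basis.piTensorProduct_repr_tprod_apply]
        exact Finset.prod_congr rfl fun i _ => hr _ _ _
      | add y y' hy hy' => simp only [map_add, hy, hy']
    refine B.ext_elem fun J => ?_
    change B.coord J _ = B.coord J _
    rw [h₂, h₁, h₁]
    choose τ hτ using fun i => hs₁ (l i) (J i)
    have : flat (fun i => s (l i) (J i)) =
        flat J ∘ ((blocks l h).permCongr (Equiv.sigmaCongrRight τ)) := by
      funext p
      obtain ⟨q, rfl⟩ := (blocks l h).surjective p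
      rw [Function.comp_apply, Equiv.permCongr_apply, Equiv.symm_apply_apply, hflat]
      exact (hflat (fun i => s (l i) (J i)) q).trans (congrFun (hτ q.1) q.2)
    rw [this, hinv]

set_option synthInstance.maxHeartbeats 200000 in
theorem exists_retraction (k : Type u) [CommRing k] (U : Type u) [AddCommGroup U] [Module k U]
    [Module.Finite k U] [Module.Projective k U] :
    ∃ r : ∀ d : ℕ, (⨂[k] (_ : Fin d), U) →ₗ[k] SymTensor k d U,
      (∀ d, ∀ x : SymTensor k d U, r d x.1 = x) ∧
      ∀ {n d : ℕ} (l : Fin n → ℕ) (h : ∑ i, l i = d) (x : SymTensor k d U),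
        inclSym k U l (PiTensorProduct.map (fun i => r (l i)) (bracket k U l h x.1)) =
          bracket k U l h x.1 := by
  obtain ⟨m, p, hp⟩ := Module.Finite.exists_fin' k U
  obtain ⟨s, hs⟩ := Module.projective_lifting_property p LinearMap.id hp
  obtain ⟨r, hr₁, hr₂⟩ := exists_retraction_free k m
  have hps : ∀ {d : ℕ} (x : ⨂[k] (_ : Fin d), U),
      PiTensorProduct.map (fun _ => p) (PiTensorProduct.map (fun _ => s) x) = x := by
    intro d x
    rw [← LinearMap.comp_apply, ← PiTensorProduct.map_comp, hs, PiTensorProduct.map_id]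
    rfl
  refine ⟨fun d => SymTensor.map d p ∘ₗ r d ∘ₗ PiTensorProduct.map (fun _ => s), ?_, ?_⟩
  · intro d x
    have : PiTensorProduct.map (fun _ => s) x.1 = (SymTensor.map d s x).1 := rfl
    simp only [LinearMap.comp_apply, this, hr₁]
    exact Subtype.ext (hps x.1)
  · intro n d l h x
    have key : ∀ z : ⨂[k] i : Fin n, ⨂[k] (_ : Fin (l i)), U,
        inclSym k U l (PiTensorProduct.map (fun i => SymTensor.map (l i) p ∘ₗ r (l i) ∘ₗ
          PiTensorProduct.map (fun _ => s)) z) =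
        PiTensorProduct.map (fun i => PiTensorProduct.map (fun _ => p))
          (inclSym k (Fin m → k) l (PiTensorProduct.map (fun i => r (l i))
            (PiTensorProduct.map (fun i => PiTensorProduct.map (fun _ => s)) z))) := by
      intro z
      induction z using PiTensorProduct.induction_on with
      | smul_tprod c v =>
        simp only [map_smul, inclSym, PiTensorProduct.map_tprod]
        rfl
      | add y y' hy hy' => simp only [map_add, hy, hy']
    rw [key, ← bracket_map]
    have : PiTensorProduct.map (fun _ => s) x.1 = (SymTensor.map d s x).1 := rfl
    rw [this, hr₂, ← bracket_map, ← this, hps]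

theorem inclSym_injective (k : Type u) [CommRing k] (U : Type u) [AddCommGroup U] [Module k U]
    [Module.Finite k U] [Module.Projective k U] {n : ℕ} (l : Fin n → ℕ) :
    Function.Injective (inclSym k U l) := by
  obtain ⟨r, hr, -⟩ := exists_retraction k U
  refine Function.LeftInverse.injective (g := PiTensorProduct.map (fun i => r (l i))) fun z => ?_
  rw [inclSym, ← LinearMap.comp_apply, ← PiTensorProduct.map_comp]
  have : (fun i => r (l i) ∘ₗ (SymTensor k (l i) U).subtype) = fun i => LinearMap.id := by
    funext i
    exact LinearMap.ext (hr (l i))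
  rw [this, PiTensorProduct.map_id]
  rfl

theorem exists_comul (k : Type u) [CommRing k] (U : Type u) [AddCommGroup U] [Module k U]
    [Module.Finite k U] [Module.Projective k U] {n d : ℕ} (l : Fin n → ℕ) (h : ∑ i, l i = d) :
    ∃ D : SymTensor k d U →ₗ[k] ⨂[k] i : Fin n, SymTensor k (l i) U,
      ∀ x, inclSym k U l (D x) = bracket k U l h x.1 := by
  obtain ⟨r, -, hr⟩ := exists_retraction k U
  exact ⟨PiTensorProduct.map (fun i => r (l i)) ∘ₗ bracket k U l h ∘ₗ (SymTensor k d U).subtype,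
    fun x => hr l h x⟩

/-- For `U` finitely generated projective and `d = λ₁ + ⋯ + λₙ`, the comultiplication
`Γ^d U → Γ^{λ₁} U ⊗ ⋯ ⊗ Γ^{λₙ} U`: the unique map whose composite with the injection
`Γ^{λ₁} U ⊗ ⋯ ⊗ Γ^{λₙ} U → U^{⊗ λ₁} ⊗ ⋯ ⊗ U^{⊗ λₙ} = U^{⊗ d}` is the inclusion of `Γ^d U`. -/
def comul (k : Type u) [CommRing k] (U : Type u) [AddCommGroup U] [Module k U]
    [Module.Finite k U] [Module.Projective k U] {n d : ℕ} (l : Fin n → ℕ) (h : ∑ i, l i = d) :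
    SymTensor k d U →ₗ[k] ⨂[k] i : Fin n, SymTensor k (l i) U :=
  (exists_comul k U l h).choose

theorem inclSym_comul (k : Type u) [CommRing k] (U : Type u) [AddCommGroup U] [Module k U]
    [Module.Finite k U] [Module.Projective k U] {n d : ℕ} (l : Fin n → ℕ) (h : ∑ i, l i = d)
    (x : SymTensor k d U) : inclSym k U l (comul k U l h x) = bracket k U l h x.1 :=
  (exists_comul k U l h).choose_spec x

theorem comul_pow [Module.Finite k U] [Module.Projective k U]
    {n d : ℕ} (l : Fin n → ℕ) (h : ∑ i, l i = d) (u : U) :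
    comul k U l h (SymTensor.pow d u) = ⨂ₜ[k] i, SymTensor.pow (l i) u := by
  apply inclSym_injective k U l
  rw [inclSym_comul]
  simp only [SymTensor.pow, bracket_tprod, inclSym, PiTensorProduct.map_tprod]
  rfl

theorem comul_map₂ [Module.Finite k U] [Module.Projective k U] [Module.Finite k V]
    [Module.Projective k V] [Module.Finite k W] [Module.Projective k W]
    {n d : ℕ} (l : Fin n → ℕ) (h : ∑ i, l i = d) (β : U →ₗ[k] V →ₗ[k] W)
    (x : SymTensor k d U) (y : SymTensor k d V) :
    comul k W l h (SymTensor.map₂ d β x y) =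
      PiTensorProduct.map₂ (fun i => SymTensor.map₂ (l i) β) (comul k U l h x)
        (comul k V l h y) := by
  have key : ∀ (a : ⨂[k] i : Fin n, SymTensor k (l i) U) (b : ⨂[k] i : Fin n, SymTensor k (l i) V),
      inclSym k W l (PiTensorProduct.map₂ (fun i => SymTensor.map₂ (l i) β) a b) =
      PiTensorProduct.map₂ (fun i => PiTensorProduct.map₂ (fun _ : Fin (l i) => β))
        (inclSym k U l a) (inclSym k V l b) := by
    intro a b
    induction a using PiTensorProduct.induction_on with
    | smul_tprod r u =>
      induction b using PiTensorProduct.induction_on with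
      | smul_tprod s v =>
        simp only [map_smul, LinearMap.smul_apply, PiTensorProduct.map₂_tprod_tprod, inclSym,
          PiTensorProduct.map_tprod]
        rfl
      | add y y' hy hy' => simp only [map_add, hy, hy']
    | add x x' hx hx' => simp only [map_add, LinearMap.add_apply, hx, hx']
  apply inclSym_injective k W l
  rw [key, inclSym_comul, inclSym_comul, inclSym_comul, ← bracket_map₂]
  rfl

end SymmetricTensors

/-! ### The category of degree `d` divided powers -/

/-- Finitely generated projective `k`-modules. -/
structure ProjMod (k : Type u) [CommRing k] : Type (u + 1) where
  /-- the underlying module -/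
  carrier : Type u
  [addCommGroup : AddCommGroup carrier]
  [module : Module k carrier]
  [finite : Module.Finite k carrier]
  [projective : Module.Projective k carrier]

instance (k : Type u) [CommRing k] : CoeSort (ProjMod k) (Type u) := ⟨ProjMod.carrier⟩

attribute [instance] ProjMod.addCommGroup ProjMod.module ProjMod.finite ProjMod.projective

/-- The objects of the category `Γ^d P_k` of degree `d` divided powers: the finitely generated
projective `k`-modules. -/
structure DivPow (k : Type u) [CommRing k] (d : ℕ) : Type (u + 1) where
  /-- the underlying finitely generated projective module -/
  mod : ProjMod k

variable {k : Type u} [CommRing k] {d : ℕ}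

/-- Composition of linear maps `(f, g) ↦ g ∘ f` as a bilinear map. -/
abbrev compBilin (k U V W : Type u) [CommRing k] [AddCommGroup U] [Module k U]
    [AddCommGroup V] [Module k V] [AddCommGroup W] [Module k W] :
    (U →ₗ[k] V) →ₗ[k] (V →ₗ[k] W) →ₗ[k] (U →ₗ[k] W) :=
  (LinearMap.llcomp k U V W).flip

/-- Morphisms `V ⟶ W` in `Γ^d P_k` are the elements of `Γ^d Hom(V, W)`; the composition is induced
by the composition `Hom(U, V) × Hom(V, W) → Hom(U, W)` of linear maps. -/
instance : Category.{u} (DivPow k d) where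
  Hom V W := SymTensor k d (V.mod →ₗ[k] W.mod)
  id V := SymTensor.pow d LinearMap.id
  comp {U V W} f g := SymTensor.map₂ d (compBilin k U.mod V.mod W.mod) f g
  id_comp {V W} f := by
    apply Subtype.ext
    obtain ⟨f, hf⟩ := f
    rw [SymTensor.map₂_val]
    simp only [SymTensor.pow]
    clear hf
    induction f using PiTensorProduct.induction_on with
    | smul_tprod r f =>
      simp only [map_smul, PiTensorProduct.map₂_tprod_tprod]
      rfl
    | add x y hx hy => simp only [map_add, hx, hy]
  comp_id {V W} f := by
    apply Subtype.ext
    obtain ⟨f, hf⟩ := f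
    rw [SymTensor.map₂_val]
    simp only [SymTensor.pow]
    clear hf
    induction f using PiTensorProduct.induction_on with
    | smul_tprod r f =>
      simp only [map_smul, LinearMap.smul_apply, PiTensorProduct.map₂_tprod_tprod]
      rfl
    | add x y hx hy => simp only [map_add, LinearMap.add_apply, hx, hy]
  assoc {U V W X} f g h := by
    apply Subtype.ext
    obtain ⟨f, hf⟩ := f
    obtain ⟨g, hg⟩ := g
    obtain ⟨h, hh⟩ := h
    simp only [SymTensor.map₂_val]
    clear hf hg hh
    induction f using PiTensorProduct.induction_on with
    | smul_tprod r f =>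
      induction g using PiTensorProduct.induction_on with
      | smul_tprod s g =>
        induction h using PiTensorProduct.induction_on with
        | smul_tprod t h =>
          simp only [map_smul, LinearMap.smul_apply, PiTensorProduct.map₂_tprod_tprod]
          rfl
        | add x y hx hy => simp only [map_add, hx, hy]
      | add x y hx hy => simp only [map_add, LinearMap.add_apply, hx, hy]
    | add x y hx hy => simp only [map_add, LinearMap.add_apply, hx, hy]

section HomModule

/-- The sum of morphisms is the one of `Γ^d Hom(V, W)`. -/
abbrev DivPow.homGroup (V W : DivPow k d) : AddCommGroup (V ⟶ W) :=
  inferInstanceAs (AddCommGroup (SymTensor k d (V.mod →ₗ[k] W.mod)))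

attribute [local instance] DivPow.homGroup

/-- The `k`-module structure on morphisms is the one of `Γ^d Hom(V, W)`. -/
abbrev DivPow.homModule (V W : DivPow k d) : Module k (V ⟶ W) :=
  inferInstanceAs (Module k (SymTensor k d (V.mod →ₗ[k] W.mod)))

attribute [local instance] DivPow.homModule

theorem DivPow.comp_def {U V W : DivPow k d} (f : U ⟶ V) (g : V ⟶ W) :
    f ≫ g = SymTensor.map₂ d (compBilin k U.mod V.mod W.mod) f g := rfl

instance : Preadditive (DivPow k d) where
  homGroup := DivPow.homGroup
  add_comp U V W f f' g := by
    exact LinearMap.map_add₂ (SymTensor.map₂ d (compBilin k U.mod V.mod W.mod)) f f' g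
  comp_add U V W f g g' :=
    map_add (SymTensor.map₂ d (compBilin k U.mod V.mod W.mod) f) g g'

instance : Linear k (DivPow k d) where
  homModule := DivPow.homModule
  smul_comp U V W r f g :=
    LinearMap.map_smul₂ (SymTensor.map₂ d (compBilin k U.mod V.mod W.mod)) r f g
  comp_smul U V W f r g :=
    map_smul (SymTensor.map₂ d (compBilin k U.mod V.mod W.mod) f) r g

end HomModule

theorem exists_hom_retract (V W : ProjMod k) :
    ∃ (a b : ℕ) (i : (V →ₗ[k] W) →ₗ[k] ((Fin a → k) →ₗ[k] (Fin b → k)))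
      (p : ((Fin a → k) →ₗ[k] (Fin b → k)) →ₗ[k] (V →ₗ[k] W)), p ∘ₗ i = LinearMap.id := by
  obtain ⟨a, p, hp⟩ := Module.Finite.exists_fin' k V
  obtain ⟨s, hs⟩ := Module.projective_lifting_property p LinearMap.id hp
  obtain ⟨b, q, hq⟩ := Module.Finite.exists_fin' k W
  obtain ⟨t, ht⟩ := Module.projective_lifting_property q LinearMap.id hq
  refine ⟨a, b, (LinearMap.lcomp k (Fin b → k) p) ∘ₗ (LinearMap.llcomp k V W (Fin b → k) t),
    (LinearMap.lcomp k W s) ∘ₗ (LinearMap.llcomp k (Fin a → k) (Fin b → k) W q), ?_⟩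
  ext f v
  have h₁ := LinearMap.congr_fun hs v
  have h₂ := LinearMap.congr_fun ht (f v)
  simp only [LinearMap.comp_apply, LinearMap.id_apply] at h₁ h₂
  simp [h₁, h₂]

instance (V W : ProjMod k) : Module.Finite k (V →ₗ[k] W) := by
  obtain ⟨a, b, i, p, h⟩ := exists_hom_retract V W
  exact Module.Finite.of_surjective p
    (Function.LeftInverse.surjective (g := i) (LinearMap.congr_fun h))

instance (V W : ProjMod k) : Module.Projective k (V →ₗ[k] W) := by
  obtain ⟨a, b, i, p, h⟩ := exists_hom_retract V W
  exact Module.Projective.of_split i p h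

/-- The module `k`, as an object of `Γ^d P_k`. -/
def DivPow.unit (k : Type u) [CommRing k] (d : ℕ) : DivPow k d := ⟨⟨k⟩⟩

/-- The tensor product `V ⊗ W` over `k`, as an object of `Γ^d P_k`. -/
def DivPow.tensorObj (V W : DivPow k d) : DivPow k d := ⟨⟨V.mod ⊗[k] W.mod⟩⟩

/-- The tensor product of morphisms in `Γ^d P_k`:
`Γ^d Hom(V,V') × Γ^d Hom(W,W') → Γ^d (Hom(V,V') ⊗ Hom(W,W')) → Γ^d Hom(V ⊗ W, V' ⊗ W')`. -/
def DivPow.tensorHom {V V' W W' : DivPow k d} (f : V ⟶ V') (g : W ⟶ W') :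
    V.tensorObj W ⟶ V'.tensorObj W' :=
  SymTensor.map₂ d (TensorProduct.mapBilinear (RingHom.id k) V.mod W.mod V'.mod W'.mod) f g

theorem DivPow.tensorHom_id (V W : DivPow k d) :
    DivPow.tensorHom (𝟙 V) (𝟙 W) = 𝟙 (V.tensorObj W) := by
  apply Subtype.ext
  change PiTensorProduct.map₂ _ (⨂ₜ[k] _, LinearMap.id) (⨂ₜ[k] _, LinearMap.id) =
    ⨂ₜ[k] _, LinearMap.id
  rw [PiTensorProduct.map₂_tprod_tprod]
  simp

theorem map₂_mapBilinear_comp {U U' V V' W W' : ProjMod k}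
    (f : ⨂[k] (_ : Fin d), (U →ₗ[k] V)) (g : ⨂[k] (_ : Fin d), (V →ₗ[k] W))
    (f' : ⨂[k] (_ : Fin d), (U' →ₗ[k] V')) (g' : ⨂[k] (_ : Fin d), (V' →ₗ[k] W')) :
    PiTensorProduct.map₂ (fun _ => TensorProduct.mapBilinear (RingHom.id k) U U' W W')
        (PiTensorProduct.map₂ (fun _ => compBilin k U V W) f g)
        (PiTensorProduct.map₂ (fun _ => compBilin k U' V' W') f' g') =
      PiTensorProduct.map₂ (fun _ => compBilin k (U ⊗[k] U') (V ⊗[k] V') (W ⊗[k] W'))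
        (PiTensorProduct.map₂
          (fun _ => TensorProduct.mapBilinear (RingHom.id k) U U' V V') f f')
        (PiTensorProduct.map₂
          (fun _ => TensorProduct.mapBilinear (RingHom.id k) V V' W W') g g') := by
  induction f using PiTensorProduct.induction_on with
  | smul_tprod r f =>
    induction g using PiTensorProduct.induction_on with
    | smul_tprod s g =>
      induction f' using PiTensorProduct.induction_on with
      | smul_tprod t f' =>
        induction g' using PiTensorProduct.induction_on with
        | smul_tprod t' g' =>
          simp only [map_smul, LinearMap.smul_apply, PiTensorProduct.map₂_tprod_tprod, smul_smul]
          have : ∀ i, TensorProduct.mapBilinear (RingHom.id k) U U' W W'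
              (compBilin k U V W (f i) (g i)) (compBilin k U' V' W' (f' i) (g' i)) =
              compBilin k (U ⊗[k] U') (V ⊗[k] V') (W ⊗[k] W')
              (TensorProduct.mapBilinear (RingHom.id k) U U' V V' (f i) (f' i))
              (TensorProduct.mapBilinear (RingHom.id k) V V' W W' (g i) (g' i)) :=
            fun i => TensorProduct.map_comp _ _ _ _
          simp only [this]
          congr 1
          ring
        | add x y hx hy => simp only [map_add, hx, hy]
      | add x y hx hy => simp only [map_add, LinearMap.add_apply, hx, hy]
    | add x y hx hy => simp only [map_add, LinearMap.add_apply, hx, hy]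
  | add x y hx hy => simp only [map_add, LinearMap.add_apply, hx, hy]

theorem DivPow.tensorHom_comp {U U' V V' W W' : DivPow k d} (f : U ⟶ V) (g : V ⟶ W)
    (f' : U' ⟶ V') (g' : V' ⟶ W') :
    DivPow.tensorHom (f ≫ g) (f' ≫ g') = DivPow.tensorHom f f' ≫ DivPow.tensorHom g g' :=
  Subtype.ext (map₂_mapBilinear_comp f.1 g.1 f'.1 g'.1)

/-! ### Strict polynomial functors -/

/-- The property of a functor `Γ^d P_k ⥤ Mod k` of being `k`-linear. -/
def isLinear (k : Type u) [CommRing k] (d : ℕ) : ObjectProperty (DivPow k d ⥤ ModuleCat.{u} k) :=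
  fun F => F.Additive ∧ F.Linear k

/-- The category `Rep Γ^d_k` of strict polynomial functors of degree `d`: the `k`-linear functors
from `Γ^d P_k` to `k`-modules. -/
abbrev StrictPoly (k : Type u) [CommRing k] (d : ℕ) := (isLinear k d).FullSubcategory

instance (X : StrictPoly k d) : X.obj.Additive := X.property.1

instance (X : StrictPoly k d) : X.obj.Linear k := X.property.2

/-- The contravariant functor `V ↦ Γ^{d,V} = Hom_{Γ^d P_k}(V, -)` into strict polynomial
functors. -/
def represent (k : Type u) [CommRing k] (d : ℕ) : (DivPow k d)ᵒᵖ ⥤ StrictPoly k d :=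
  (isLinear k d).lift (linearCoyoneda k (DivPow k d))
    (fun V => ⟨inferInstance, ⟨fun f r => by
      ext g
      exact Linear.comp_smul _ _ _ g r f⟩⟩)

/-- The value `X(V)` on morphisms, as a `k`-linear map
`Γ^d Hom(V, W) → Hom(X(V), X(W))`. -/
def StrictPoly.mapHom (X : StrictPoly k d) (V W : DivPow k d) :
    SymTensor k d (V.mod →ₗ[k] W.mod) →ₗ[k] (X.obj.obj V →ₗ[k] X.obj.obj W) where
  toFun f := (X.obj.map (show V ⟶ W from f)).hom
  map_add' f g := by
    change (X.obj.map ((show V ⟶ W from f) + (show V ⟶ W from g))).hom = _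
    rw [Functor.map_add]
    rfl
  map_smul' r f := by
    change (X.obj.map (r • (show V ⟶ W from f))).hom = _
    rw [Functor.map_smul]
    rfl

theorem StrictPoly.mapHom_id (X : StrictPoly k d) (V : DivPow k d) :
    X.mapHom V V (SymTensor.pow d LinearMap.id) = LinearMap.id := by
  change (X.obj.map (𝟙 V)).hom = _
  rw [CategoryTheory.Functor.map_id]
  rfl

theorem StrictPoly.mapHom_comp (X : StrictPoly k d) (U V W : DivPow k d)
    (f : SymTensor k d (U.mod →ₗ[k] V.mod)) (g : SymTensor k d (V.mod →ₗ[k] W.mod)) :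
    X.mapHom U W (SymTensor.map₂ d (compBilin k U.mod V.mod W.mod) f g) =
      X.mapHom V W g ∘ₗ X.mapHom U V f := by
  change (X.obj.map ((show U ⟶ V from f) ≫ (show V ⟶ W from g))).hom = _
  rw [CategoryTheory.Functor.map_comp]
  rfl

section ExternalTensor

variable {n : ℕ} {l : Fin n → ℕ} (h : ∑ i, l i = d) (X : ∀ i, StrictPoly k (l i))

/-- The action of `Γ^d Hom(V, W)` on the external tensor product, through
`Γ^d Hom(V,W) → Γ^{λ₁} Hom(V,W) ⊗ ⋯ ⊗ Γ^{λₙ} Hom(V,W)`. -/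
def externalMap (V W : ProjMod k) : SymTensor k d (V →ₗ[k] W) →ₗ[k]
    ((⨂[k] i : Fin n, (X i).obj.obj ⟨V⟩) →ₗ[k] ⨂[k] i : Fin n, (X i).obj.obj ⟨W⟩) :=
  PiTensorProduct.piTensorHomMap ∘ₗ
    PiTensorProduct.map (fun i => (X i).mapHom ⟨V⟩ ⟨W⟩) ∘ₗ comul k (V →ₗ[k] W) l h

theorem externalMap_id (V : ProjMod k) :
    externalMap h X V V (SymTensor.pow d LinearMap.id) = LinearMap.id := by
  rw [externalMap, LinearMap.comp_apply, LinearMap.comp_apply, comul_pow,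
    PiTensorProduct.map_tprod]
  have : (fun i => (X i).mapHom ⟨V⟩ ⟨V⟩ (SymTensor.pow (l i) LinearMap.id)) =
      fun i => LinearMap.id := funext fun i => (X i).mapHom_id ⟨V⟩
  rw [this, PiTensorProduct.piTensorHomMap_tprod_eq_map, PiTensorProduct.map_id]

theorem externalMap_comp (U V W : ProjMod k)
    (f : SymTensor k d (U →ₗ[k] V)) (g : SymTensor k d (V →ₗ[k] W)) :
    externalMap h X U W (SymTensor.map₂ d (compBilin k U V W) f g) =
      externalMap h X V W g ∘ₗ externalMap h X U V f := by
  simp only [externalMap, LinearMap.comp_apply]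
  rw [comul_map₂]
  generalize comul k (U →ₗ[k] V) l h f = a
  generalize comul k (V →ₗ[k] W) l h g = b
  induction a using PiTensorProduct.induction_on with
  | smul_tprod r a =>
    induction b using PiTensorProduct.induction_on with
    | smul_tprod s b =>
      simp only [map_smul, LinearMap.smul_apply, PiTensorProduct.map₂_tprod_tprod,
        PiTensorProduct.map_tprod, LinearMap.smul_comp, LinearMap.comp_smul,
        PiTensorProduct.piTensorHomMap_tprod_eq_map]
      rw [← PiTensorProduct.map_comp]
      rw [smul_comm]
      congr 3
      exact (funext fun i => (X i).mapHom_comp ⟨U⟩ ⟨V⟩ ⟨W⟩ (a i) (b i))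
    | add x y hx hy => simp only [map_add, hx, hy, LinearMap.add_comp]
  | add x y hx hy => simp only [map_add, LinearMap.add_apply, hx, hy, LinearMap.comp_add]

/-- The external tensor product `X₁ ⊗ ⋯ ⊗ Xₙ` in `Rep Γ^d_k` of strict polynomial functors `Xᵢ`
of degrees `λᵢ`, where `d = λ₁ + ⋯ + λₙ`: it sends `V` to `X₁(V) ⊗ ⋯ ⊗ Xₙ(V)`. -/
def externalTensor : StrictPoly k d where
  obj :=
    { obj := fun V => ModuleCat.of k (⨂[k] i : Fin n, (X i).obj.obj ⟨V.mod⟩)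
      map := fun {V W} f => ModuleCat.ofHom (externalMap h X V.mod W.mod f)
      map_id := fun V => ModuleCat.hom_ext (externalMap_id h X V.mod)
      map_comp := fun {U V W} f g =>
        ModuleCat.hom_ext (externalMap_comp h X U.mod V.mod W.mod f g) }
  property := ⟨⟨fun {V W f g} => ModuleCat.hom_ext (map_add (externalMap h X V.mod W.mod) f g)⟩,
    ⟨fun {V W} f r => ModuleCat.hom_ext (map_smul (externalMap h X V.mod W.mod) r f)⟩⟩

end ExternalTensor

/-! ### Existence of colimits -/

/-- A linear isomorphism gives an isomorphism in `Γ^d P_k`. -/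
def DivPow.isoOfEquiv {V W : DivPow k d} (e : V.mod ≃ₗ[k] W.mod) : V ≅ W where
  hom := SymTensor.pow d e.toLinearMap
  inv := SymTensor.pow d e.symm.toLinearMap
  hom_inv_id := by
    apply Subtype.ext
    change PiTensorProduct.map₂ _ (⨂ₜ[k] _, _) (⨂ₜ[k] _, _) = ⨂ₜ[k] _, LinearMap.id
    rw [PiTensorProduct.map₂_tprod_tprod]
    congr 1
    funext i
    ext x
    simp
  inv_hom_id := by
    apply Subtype.ext
    change PiTensorProduct.map₂ _ (⨂ₜ[k] _, _) (⨂ₜ[k] _, _) = ⨂ₜ[k] _, LinearMap.id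
    rw [PiTensorProduct.map₂_tprod_tprod]
    congr 1
    funext i
    ext x
    simp

instance : EssentiallySmall.{u} (DivPow k d) := by
  rw [essentiallySmall_iff]
  refine ⟨?_, inferInstance⟩
  let S := {N : Σ m : ℕ, Submodule k (Fin m → k) // Module.Projective k ((Fin N.1 → k) ⧸ N.2)}
  let g : S → DivPow k d := fun N =>
    haveI := N.2
    ⟨⟨(Fin N.1.1 → k) ⧸ N.1.2⟩⟩
  refine small_of_surjective (α := S) (f := fun N => toSkeleton (g N)) fun W => ?_
  obtain ⟨V, rfl⟩ := Quotient.exists_rep W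
  obtain ⟨m, p, hp⟩ := Module.Finite.exists_fin' k V.mod
  let e := p.quotKerEquivOfSurjective hp
  refine ⟨⟨⟨m, LinearMap.ker p⟩, Module.Projective.of_equiv e.symm⟩, ?_⟩
  exact Quotient.sound ⟨DivPow.isoOfEquiv e⟩

instance : LocallySmall.{u} (StrictPoly k d) where
  hom_small X Y := by
    let S := SmallModel.{u} (DivPow k d)
    let E : S ⥤ DivPow k d := (equivSmallModel (DivPow k d)).inverse
    refine small_of_injective (β := ∀ s : S, X.obj.obj (E.obj s) ⟶ Y.obj.obj (E.obj s))
      (f := fun φ s => φ.hom.app (E.obj s)) fun φ ψ h => ?_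
    ext : 1
    ext V : 2
    let i := (equivSmallModel (DivPow k d)).unitIso.app V
    have hV := congrFun h ((equivSmallModel (DivPow k d)).functor.obj V)
    have h₁ := φ.hom.naturality i.hom
    have h₂ := ψ.hom.naturality i.hom
    have h₃ : φ.hom.app V ≫ Y.obj.map i.hom = ψ.hom.app V ≫ Y.obj.map i.hom :=
      h₁.symm.trans ((congrArg (fun t => X.obj.map i.hom ≫ t) hV).trans h₂)
    exact (cancel_mono _).1 h₃

section Colimits

variable (J : Type*) [Category* J] [EssentiallySmall.{u} J]

instance hasColimitsOfShape_moduleCat : HasColimitsOfShape J (ModuleCat.{u} k) :=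
  hasColimitsOfShape_of_essentiallySmall.{u} J _

instance : (isLinear k d).IsClosedUnderColimitsOfShape J where
  colimitsOfShape_le := by
    rintro F ⟨p⟩
    have ext : ∀ {V : DivPow k d} {M : ModuleCat.{u} k} (f g : F.obj V ⟶ M),
        (∀ j, (p.ι.app j).app V ≫ f = (p.ι.app j).app V ≫ g) → f = g := fun {V M} f g h =>
      (isColimitOfPreserves ((evaluation _ _).obj V) p.isColimit).hom_ext h
    refine ⟨⟨fun {V W f g} => ext _ _ fun j => ?_⟩, ⟨fun {V W} f r => ext _ _ fun j => ?_⟩⟩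
    · have := (p.prop_diag_obj j).1
      have hn : ∀ f : V ⟶ W, (p.ι.app j).app V ≫ F.map f =
        (p.diag.obj j).map f ≫ (p.ι.app j).app W := fun f => ((p.ι.app j).naturality f).symm
      rw [Preadditive.comp_add, hn, hn, hn, Functor.map_add, Preadditive.add_comp]
    · have := (p.prop_diag_obj j).1
      have := (p.prop_diag_obj j).2
      have hn : ∀ f : V ⟶ W, (p.ι.app j).app V ≫ F.map f =
        (p.diag.obj j).map f ≫ (p.ι.app j).app W := fun f => ((p.ι.app j).naturality f).symm
      rw [Linear.comp_smul, hn, hn, Functor.map_smul, Linear.smul_comp]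

instance : HasColimitsOfShape J (StrictPoly k d) := inferInstance

end Colimits

instance : HasFiniteCoproducts (StrictPoly k d) := ⟨fun _ => inferInstance⟩

instance : HasFiniteBiproducts (StrictPoly k d) := HasFiniteBiproducts.of_hasFiniteCoproducts

/-! ### The internal tensor product -/

/-- The bifunctor `(Γ^{d,V}, Γ^{d,W}) ↦ Γ^{d,V} ⊗ Γ^{d,W} = Γ^{d,V ⊗ W}` on representable
functors. -/
def tensorRepresent (k : Type u) [CommRing k] (d : ℕ) :
    (DivPow k d)ᵒᵖ ⥤ (DivPow k d)ᵒᵖ ⥤ StrictPoly k d where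
  obj V :=
    { obj := fun W => (represent k d).obj (op (V.unop.tensorObj W.unop))
      map := fun {W W'} g => (represent k d).map (DivPow.tensorHom (𝟙 V.unop) g.unop).op
      map_id := fun W => by
        rw [unop_id, DivPow.tensorHom_id, op_id, CategoryTheory.Functor.map_id]
      map_comp := fun {W W' W''} g g' => by
        rw [← CategoryTheory.Functor.map_comp, ← op_comp, ← DivPow.tensorHom_comp,
          Category.id_comp, unop_comp] }
  map {V V'} f :=
    { app := fun W => (represent k d).map (DivPow.tensorHom f.unop (𝟙 W.unop)).op
      naturality := fun {W W'} g => by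
        simp only [← CategoryTheory.Functor.map_comp, ← op_comp, ← DivPow.tensorHom_comp,
          Category.id_comp, Category.comp_id] }
  map_id V := by
    ext W : 2
    exact (congrArg (fun φ => (represent k d).map (Quiver.Hom.op φ))
      (DivPow.tensorHom_id V.unop W.unop)).trans ((represent k d).map_id _)
  map_comp {V V' V''} f f' := by
    ext W : 2
    simp only [NatTrans.comp_app, ← CategoryTheory.Functor.map_comp, ← op_comp,
      ← DivPow.tensorHom_comp, Category.id_comp, unop_comp]

/-- The category `C_X` of representable functors over `X`: its objects are the natural
transformations `Γ^{d,V} ⟶ X`, its morphisms are the morphisms `Γ^{d,V} ⟶ Γ^{d,W}` over `X`,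
given by their representing morphisms `W ⟶ V`. -/
abbrev RepresentablesOver (X : StrictPoly k d) := CostructuredArrow (represent k d) X

/-- The functor `V ↦ Γ^{d,V} ⊗ Y`, where `Γ^{d,V} ⊗ Y` is the colimit of `Γ^{d,V} ⊗ Γ^{d,W}` over
all `Γ^{d,W} ⟶ Y` in `C_Y`. -/
def representTensor (Y : StrictPoly k d) : (DivPow k d)ᵒᵖ ⥤ StrictPoly k d :=
  tensorRepresent k d ⋙
    (Functor.whiskeringLeft (RepresentablesOver Y) (DivPow k d)ᵒᵖ (StrictPoly k d)).obj
      (CostructuredArrow.proj (represent k d) Y) ⋙ colim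

/-- The internal tensor product `X ⊗ Y` of strict polynomial functors: the colimit of
`Γ^{d,V} ⊗ Y` over all `Γ^{d,V} ⟶ X` in `C_X`. -/
def internalTensor (X Y : StrictPoly k d) : StrictPoly k d :=
  colimit (CostructuredArrow.proj (represent k d) X ⋙ representTensor Y)

/-! ### Compositions -/

/-- The set `Λ(n, d)` of compositions of `d` in `n` parts. -/
abbrev Compositions (n d : ℕ) := {l : Fin n → ℕ // ∑ i, l i = d}

/-- The strict polynomial functor `Γ^λ = Γ^{λ₁} ⊗ ⋯ ⊗ Γ^{λₙ}`, the external tensor product of the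
representable functors `Γ^{λᵢ} = Γ^{λᵢ,k}`. -/
def divPowFunctor (k : Type u) [CommRing k] {n d : ℕ} (lam : Compositions n d) : StrictPoly k d :=
  externalTensor lam.2 (fun i => (represent k (lam.1 i)).obj (op (DivPow.unit k (lam.1 i))))

/-- The set `A^λ_μ` of `m × n` matrices of natural numbers with row sums `λ` and column
sums `μ`. -/
abbrev MarginMatrices {m n d : ℕ} (lam : Compositions m d) (mu : Compositions n d) :=
  {A : Matrix (Fin m) (Fin n) ℕ // (∀ i, ∑ j, A i j = lam.1 i) ∧ ∀ j, ∑ i, A i j = mu.1 j}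

instance {m n d : ℕ} (lam : Compositions m d) (mu : Compositions n d) :
    Finite (MarginMatrices lam mu) := by
  refine Finite.of_injective
    (β := Fin m → Fin n → Fin (d + 1)) (fun A i j => ⟨A.1 i j, ?_⟩) ?_
  · have h₁ : A.1 i j ≤ ∑ j, A.1 i j :=
      Finset.single_le_sum (f := fun j => A.1 i j) (fun _ _ => Nat.zero_le _) (Finset.mem_univ j)
    have h₂ : lam.1 i ≤ ∑ i, lam.1 i :=
      Finset.single_le_sum (f := lam.1) (fun _ _ => Nat.zero_le _) (Finset.mem_univ i)
    have h₃ := A.2.1 i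
    have h₄ := lam.2
    omega
  · intro A B h
    apply Subtype.ext
    funext i j
    exact congrArg Fin.val (congrFun (congrFun h i) j)

/-- A matrix `A` in `A^λ_μ` read row by row as the composition
`(a₁₁, a₁₂, …, a₂₁, a₂₂, …, a_{mn})` of `d`. -/
def MarginMatrices.toComposition {m n d : ℕ} {lam : Compositions m d} {mu : Compositions n d}
    (A : MarginMatrices lam mu) : Compositions (m * n) d :=
  ⟨fun s => A.1 (finProdFinEquiv.symm s).1 (finProdFinEquiv.symm s).2, by
    rw [← finProdFinEquiv.sum_comp]
    simp only [Equiv.symm_apply_apply]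
    rw [Fintype.sum_prod_type]
    simp only [A.2.1, lam.2]⟩

end StrictPolynomial

end

/-!
The functor `Γ^λ` is a direct summand of a representable functor, and the internal tensor product is
determined by its values on representable functors; the decomposition reduces to an identity between
idempotents in `Γ^d End(k^{mn})`.

Let `M` be free with basis `e₁, …, eₙ` and let `E_i` be the projection of `M` onto the line of `e_i`.
The weight idempotent `e_λ ∈ Γ^d End(M)` (`weightIdem`) is the sum of `E_{φ(1)} ⊗ ⋯ ⊗ E_{φ(d)}` over
the sequences `φ` in which each `i` occurs `λ_i` times. The element `e₁^{⊗ λ₁} ⊗ ⋯ ⊗ eₙ^{⊗ λₙ}` of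
`Γ^λ(M)` defines a morphism `p_λ : Γ^{d,M} ⟶ Γ^λ` (`weightProj`), and `Γ^λ` is the summand cut out by
`e_λ` because `p_λ` is pointwise surjective (`restrictLines_surjective`, by a shuffle product), is
unchanged by `e_λ` (`restrictLines_weightIdem_comp`), and has kernel killed by `e_λ`
(`weightIdem_comp_eq_zero`).

A colimit over the representable functors over a retract of a representable functor is a retract of
the value at the representing object (`CostructuredArrow.colimitRetract`), since every morphism to
the retract factors through the retraction. Applied in both variables this shows that `Γ^λ ⊗ Γ^μ` is
the summand of `Γ^{d, k^m ⊗ k^n}` cut out by `e_λ ⊗ e_μ` (`exists_retract_internalTensor`).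

Finally `e_λ ⊗ e_μ` is the sum of the `e_A` over the matrices `A` with row sums `λ` and column sums
`μ` (`tensorHom_weightEnd`): a pair of sequences of contents `λ` and `μ` is a sequence of pairs whose
content is such a matrix. The `e_A` are orthogonal, so the summand is the biproduct of the `Γ^A`
(`Retract.nonempty_iso_biproduct`).
-/

noncomputable section

/-! ### Left Kan extension of a functor to retracts of represented objects -/

namespace CategoryTheory

section ColimitRetract

universe v₁ v₂ v₃ u₁ u₂ u₃

variable {C : Type u₁} [Category.{v₁} C] {D : Type u₂} [Category.{v₂} D]
  {E : Type u₃} [Category.{v₃} E] (Y : C ⥤ D) [Y.Full] [Y.Faithful] (F : C ⥤ E)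
  {X : D} {V : C} (H : Retract X (Y.obj V))

/-- For `X` a retract of `Y.obj V` with inclusion `i`, the cocone whose leg at `g : Y.obj W ⟶ X`
is the image under `F` of the morphism `W ⟶ V` representing `g ≫ i`. -/
def CostructuredArrow.retractCocone : Cocone (CostructuredArrow.proj Y X ⋙ F) where
  pt := F.obj V
  ι :=
    { app := fun g => F.map (Y.preimage (X := g.left) (g.hom ≫ H.i))
      naturality := fun g g' f => by
        change F.map f.left ≫ F.map (Y.preimage (X := g'.left) (g'.hom ≫ H.i)) =
          F.map (Y.preimage (X := g.left) (g.hom ≫ H.i)) ≫ 𝟙 _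
        rw [← F.map_comp, Category.comp_id]
        congr 1
        apply Y.map_injective
        rw [Y.map_comp, Y.map_preimage, Y.map_preimage]
        simp }

variable [HasColimit (CostructuredArrow.proj Y X ⋙ F)]

/-- If `X` is a retract of `Y.obj V` with `Y` fully faithful, then the value at `X` of the left Kan
extension of `F` along `Y` is a retract of `F.obj V`. -/
def CostructuredArrow.colimitRetract :
    Retract (colimit (CostructuredArrow.proj Y X ⋙ F)) (F.obj V) where
  i := colimit.desc (CostructuredArrow.proj Y X ⋙ F) (retractCocone Y F H)
  r := colimit.ι (CostructuredArrow.proj Y X ⋙ F) (CostructuredArrow.mk H.r)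
  retract := by
    refine colimit.hom_ext fun g => ?_
    refine (colimit.ι_desc_assoc _ _ _).trans (.trans ?_ (Category.comp_id _).symm)
    exact colimit.w (CostructuredArrow.proj Y X ⋙ F) (CostructuredArrow.homMk
      (f := g) (f' := CostructuredArrow.mk H.r) (Y.preimage (g.hom ≫ H.i)) (by simp))

theorem CostructuredArrow.colimitRetract_r_i {e : V ⟶ V} (he : H.r ≫ H.i = Y.map e) :
    (colimitRetract Y F H).r ≫ (colimitRetract Y F H).i = F.map e := by
  refine (colimit.ι_desc _ _).trans ?_
  change F.map (Y.preimage (H.r ≫ H.i)) = _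
  rw [he, Y.preimage_map]

/-- Naturality, in the first variable of `T`, of the coprojections of the colimit of `T` over `P` in
the second variable. -/
theorem ι_whiskeringLeft_colim_map {J : Type*} [Category* J] [HasColimitsOfShape J E]
    {B : Type*} [Category* B] (P : J ⥤ C) (T : B ⥤ C ⥤ E) {b b' : B} (f : b ⟶ b') (j : J) :
    colimit.ι (P ⋙ T.obj b) j ≫
        (T ⋙ (Functor.whiskeringLeft J C E).obj P ⋙ colim).map f =
      (T.map f).app (P.obj j) ≫ colimit.ι (P ⋙ T.obj b') j :=
  ι_colimMap (Functor.whiskerLeft P (T.map f)) j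

/-- The extension of a bifunctor `T` along `Y`, first in the second and then in the first variable:
if `X` and `X'` are retracts of `Y.obj V` and `Y.obj V'`, cut out by the idempotents `Y.map e` and
`Y.map e'`, then its value at `(X, X')` is a retract of `T(V, V')`, cut out by `T(e, e')`. -/
theorem CostructuredArrow.exists_retract_bifunctor {X' : D} {V' : C}
    [∀ Z : D, HasColimitsOfShape (CostructuredArrow Y Z) E] (T : C ⥤ C ⥤ E)
    (H' : Retract X' (Y.obj V')) {e : V ⟶ V} {e' : V' ⟶ V'}
    (he : H.r ≫ H.i = Y.map e) (he' : H'.r ≫ H'.i = Y.map e') :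
    ∃ L : Retract (colimit (CostructuredArrow.proj Y X ⋙ T ⋙
        (Functor.whiskeringLeft (CostructuredArrow Y X') C E).obj (CostructuredArrow.proj Y X') ⋙
          colim)) ((T.obj V).obj V'),
      L.r ≫ L.i = (T.map e).app V' ≫ (T.obj V).map e' := by
  let G := T ⋙ (Functor.whiskeringLeft (CostructuredArrow Y X') C E).obj
    (CostructuredArrow.proj Y X') ⋙ colim
  let L₁ : Retract (colimit (CostructuredArrow.proj Y X ⋙ G)) (G.obj V) := colimitRetract Y G H
  let L₂ : Retract (G.obj V) ((T.obj V).obj V') := colimitRetract Y (T.obj V) H'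
  have h₁ : L₁.r ≫ L₁.i = G.map e := colimitRetract_r_i Y G H he
  have h₂ : L₂.r ≫ L₂.i = (T.obj V).map e' := colimitRetract_r_i Y (T.obj V) H' he'
  have h₃ : L₂.r ≫ G.map e = (T.map e).app V' ≫ L₂.r :=
    ι_whiskeringLeft_colim_map (CostructuredArrow.proj Y X') T e (CostructuredArrow.mk H'.r)
  refine ⟨L₁.trans L₂, ?_⟩
  change (L₂.r ≫ L₁.r) ≫ L₁.i ≫ L₂.i = _
  rw [Category.assoc, ← Category.assoc L₁.r, h₁, ← Category.assoc, h₃, Category.assoc, h₂]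

end ColimitRetract

/-! ### Biproduct decompositions from orthogonal idempotents -/

section Biproduct

universe v u₁

variable {C : Type u₁} [Category.{v} C] [Preadditive C] {J : Type*} [Fintype J]

/-- Let `X` be a retract of `Z` whose idempotent is the sum of the idempotents of retracts `S j`
of `Z`, the retractions of which are pairwise orthogonal to the inclusions. Then `X` is the
biproduct of the `S j`. -/
theorem Retract.nonempty_iso_biproduct {X Z : C} {S : J → C} [HasBiproduct S]
    (H : Retract X Z) (K : ∀ j, Retract (S j) Z)
    (orth : ∀ j j', j ≠ j' → (K j).i ≫ (K j').r = 0)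
    (total : H.r ≫ H.i = ∑ j, (K j).r ≫ (K j).i) : Nonempty (X ≅ ⨁ S) := by
  classical
  have orth' : ∀ j j', (K j).i ≫ (K j').r = if h : j = j' then eqToHom (congrArg S h) else 0 := by
    intro j j'
    split_ifs with h
    · subst h; simp
    · exact orth j j' h
  have hK : ∀ j j', (K j).i ≫ H.r ≫ H.i ≫ (K j').r = (K j).i ≫ (K j').r := by
    intro j j'
    rw [← Category.assoc H.r, total, Preadditive.sum_comp, Preadditive.comp_sum,
      Finset.sum_eq_single j]
    · simp
    · intro l _ hl
      rw [Category.assoc, ← Category.assoc, orth j l hl.symm, zero_comp]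
    · simp
  let b : Limits.Bicone S :=
    { pt := X
      π := fun j => H.i ≫ (K j).r
      ι := fun j => (K j).i ≫ H.r
      ι_π := fun j j' => by
        rw [Category.assoc, hK, orth'] }
  refine ⟨biproduct.uniqueUpToIso S (isBilimitOfTotal b ?_)⟩
  have : ∑ j, b.π j ≫ b.ι j = H.i ≫ (∑ j, (K j).r ≫ (K j).i) ≫ H.r := by
    simp [b, Preadditive.sum_comp, Preadditive.comp_sum]
  rw [this, ← total]
  simp [b]

end Biproduct

end CategoryTheory

namespace StrictPolynomial

/-! ### The internal tensor product of summands of representable functors -/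

section Represent
variable (k : Type u) [CommRing k] (d : ℕ)
instance : (represent k d).Full := by
  have : (represent k d ⋙ (isLinear k d).ι).Full := full_linearCoyoneda k (DivPow k d)
  exact Functor.Full.of_comp_faithful _ (isLinear k d).ι
instance : (represent k d).Faithful := by
  have : (represent k d ⋙ (isLinear k d).ι).Faithful := faithful_linearCoyoneda k (DivPow k d)
  exact Functor.Faithful.of_comp _ (isLinear k d).ι

variable {k d}
theorem represent_map_sum {J : Type*} [Fintype J] {V W : DivPow k d} (f : J → (V ⟶ W)) :
    (represent k d).map (∑ j, f j).op = ∑ j, (represent k d).map (f j).op := by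
  have hadd : ∀ f g : V ⟶ W, (represent k d).map (f + g).op =
      (represent k d).map f.op + (represent k d).map g.op := by
    intro f g
    refine ObjectProperty.hom_ext _ (NatTrans.ext (funext fun U => ModuleCat.hom_ext
      (LinearMap.ext fun h => ?_)))
    exact Preadditive.add_comp _ _ _ f g h
  exact map_sum (AddMonoidHom.mk' (fun f : V ⟶ W => (represent k d).map f.op) hadd) f _

/-- If `X` and `Y` are retracts of `Γ^{d,V}` and `Γ^{d,W}`, cut out by idempotents `e` and `e'`, then
`X ⊗ Y` is a retract of `Γ^{d,V ⊗ W}`, cut out by the idempotent `e ⊗ e'`. -/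
theorem exists_retract_internalTensor {X Y : StrictPoly k d} {V W : DivPow k d}
    (H : Retract X ((represent k d).obj (op V))) (K : Retract Y ((represent k d).obj (op W)))
    {e : V ⟶ V} {e' : W ⟶ W} (he : H.r ≫ H.i = (represent k d).map e.op)
    (he' : K.r ≫ K.i = (represent k d).map e'.op) :
    ∃ L : Retract (internalTensor X Y) ((represent k d).obj (op (V.tensorObj W))),
      L.r ≫ L.i = (represent k d).map (DivPow.tensorHom e e').op := by
  obtain ⟨L, hL⟩ := CostructuredArrow.exists_retract_bifunctor (represent k d) H
    (tensorRepresent k d) K he he'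
  refine ⟨L, hL.trans ?_⟩
  change (represent k d).map (DivPow.tensorHom e (𝟙 W)).op ≫
    (represent k d).map (DivPow.tensorHom (𝟙 V) e').op = _
  rw [← Functor.map_comp, ← op_comp, ← DivPow.tensorHom_comp, Category.id_comp, Category.comp_id]

end Represent

/-! ### Bracketing and permuting tensor factors -/

section Bracket

variable {k : Type u} [CommRing k] {U V : Type u}
  [AddCommGroup U] [Module k U] [AddCommGroup V] [Module k V] {n d : ℕ}

theorem permute_tprod (σ : Equiv.Perm (Fin d)) (u : Fin d → U) :
    permute k U σ (⨂ₜ[k] p, u p) = ⨂ₜ[k] p, u (σ.symm p) :=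
  PiTensorProduct.reindex_tprod _ _

theorem permute_mul (σ τ : Equiv.Perm (Fin d)) (x : ⨂[k] (_ : Fin d), U) :
    permute k U (σ * τ) x = permute k U σ (permute k U τ x) := by
  induction x using PiTensorProduct.induction_on with
  | smul_tprod r u => simp only [map_smul, permute_tprod]; rfl
  | add x y hx hy => simp only [map_add, hx, hy]

theorem permute_one (x : ⨂[k] (_ : Fin d), U) : permute k U 1 x = x :=
  LinearEquiv.congr_fun PiTensorProduct.reindex_refl x

theorem permute_map_family (g : Fin d → (U →ₗ[k] V)) (σ : Equiv.Perm (Fin d))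
    (x : ⨂[k] (_ : Fin d), U) :
    permute k V σ (PiTensorProduct.map g x) =
      PiTensorProduct.map (fun p => g (σ.symm p)) (permute k U σ x) := by
  induction x using PiTensorProduct.induction_on with
  | smul_tprod r u => simp only [map_smul, permute_tprod, PiTensorProduct.map_tprod]
  | add x y hx hy => simp only [map_add, hx, hy]

/-- The index of the block containing a given position. -/
def blockIndex (l : Fin n → ℕ) (h : ∑ i, l i = d) (p : Fin d) : Fin n :=
  ((blocks l h).symm p).1

theorem blockIndex_blocks (l : Fin n → ℕ) (h : ∑ i, l i = d) (q : Σ i, Fin (l i)) :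
    blockIndex l h (blocks l h q) = q.1 :=
  congrArg Sigma.fst ((blocks l h).symm_apply_apply q)

theorem bracket_map_blockIndex (l : Fin n → ℕ) (h : ∑ i, l i = d) (g : Fin n → (U →ₗ[k] V))
    (x : ⨂[k] (_ : Fin d), U) :
    bracket k V l h (PiTensorProduct.map (fun p => g (blockIndex l h p)) x) =
      PiTensorProduct.map (fun i => PiTensorProduct.map (fun _ : Fin (l i) => g i))
        (bracket k U l h x) := by
  induction x using PiTensorProduct.induction_on with
  | smul_tprod r u =>
    simp only [map_smul, PiTensorProduct.map_tprod, bracket_tprod, blockIndex_blocks]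
  | add x x' hx hx' => simp only [map_add, hx, hx']

theorem bracket_permute (l : Fin n → ℕ) (h : ∑ i, l i = d) (σ : Equiv.Perm (Fin d))
    (τ : ∀ i, Equiv.Perm (Fin (l i)))
    (hτ : ∀ i j, σ.symm (blocks l h ⟨i, j⟩) = blocks l h ⟨i, (τ i).symm j⟩)
    (x : ⨂[k] (_ : Fin d), U) :
    bracket k U l h (permute k U σ x) =
      PiTensorProduct.map (fun i => permute k U (τ i)) (bracket k U l h x) := by
  induction x using PiTensorProduct.induction_on with
  | smul_tprod r u =>
    simp only [map_smul, permute_tprod, bracket_tprod, PiTensorProduct.map_tprod]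
    congr 2
    funext i
    congr 1
    funext j
    exact congrArg u (hτ i j)
  | add x x' hx hx' => simp only [map_add, hx, hx']

/-- A permutation preserving the blocks is a product of permutations of the blocks. -/
theorem exists_block_perms (l : Fin n → ℕ) (h : ∑ i, l i = d) (σ : Equiv.Perm (Fin d))
    (hσ : ∀ p, blockIndex l h (σ p) = blockIndex l h p) :
    ∃ τ : ∀ i, Equiv.Perm (Fin (l i)), ∀ i j, σ (blocks l h ⟨i, j⟩) = blocks l h ⟨i, τ i j⟩ := by
  have key : ∀ i (j : Fin (l i)), ∃ j' : Fin (l i), σ (blocks l h ⟨i, j⟩) = blocks l h ⟨i, j'⟩ := by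
    intro i j
    obtain ⟨⟨i', j'⟩, hq⟩ := (blocks l h).surjective (σ (blocks l h ⟨i, j⟩))
    have : i' = i := by
      have := hσ (blocks l h ⟨i, j⟩)
      rwa [← hq, blockIndex_blocks, blockIndex_blocks] at this
    subst this
    exact ⟨j', hq.symm⟩
  choose t ht using key
  have inj : ∀ i, Function.Injective (t i) := by
    intro i j j' hj
    have := (ht i j).trans ((congrArg (fun a => blocks l h ⟨i, a⟩) hj).trans (ht i j').symm)
    simpa using this
  exact ⟨fun i => Equiv.ofBijective (t i) (Finite.injective_iff_bijective.mp (inj i)), ht⟩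

/-- An element of `U^{⊗ d}` which comes from `Γ^{λ₁} U ⊗ ⋯ ⊗ Γ^{λₙ} U` is fixed by the
Young subgroup `𝔖_λ`. -/
theorem bracket_permute_of_inclSym (l : Fin n → ℕ) (h : ∑ i, l i = d) (σ : Equiv.Perm (Fin d))
    (hσ : ∀ p, blockIndex l h (σ p) = blockIndex l h p)
    (x : ⨂[k] (_ : Fin d), U) (y : ⨂[k] i : Fin n, SymTensor k (l i) U)
    (hxy : bracket k U l h x = inclSym k U l y) :
    bracket k U l h (permute k U σ x) = bracket k U l h x := by
  obtain ⟨τ, hτ⟩ := exists_block_perms l h σ hσ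
  rw [bracket_permute l h σ τ, hxy]
  · rw [inclSym, ← LinearMap.comp_apply, ← PiTensorProduct.map_comp]
    congr 2
    funext i
    exact LinearMap.ext fun z => z.2 (τ i)
  · intro i j
    rw [Equiv.symm_apply_eq, hτ, Equiv.apply_symm_apply]

/-- Bracketing carries a basis to a basis. -/
theorem bracket_bijective_free (k : Type u) [CommRing k] (m : ℕ) (l : Fin n → ℕ)
    (h : ∑ i, l i = d) : Function.Bijective (bracket k (Fin m → k) l h) := by
  let B := Basis.piTensorProduct (fun i : Fin n =>
    Basis.piTensorProduct (fun _ : Fin (l i) => Pi.basisFun k (Fin m)))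
  let flat : (∀ i, Fin (l i) → Fin m) → (Fin d → Fin m) :=
    fun J p => J ((blocks l h).symm p).1 ((blocks l h).symm p).2
  have hflat : ∀ J q, flat J (blocks l h q) = J q.1 q.2 := fun J q =>
    congrArg (fun q : Σ i, Fin (l i) => J q.1 q.2) ((blocks l h).symm_apply_apply q)
  have hB : ∀ J y, B.coord J (bracket k _ l h y) = coord k m (flat J) y := by
    intro J y
    induction y using PiTensorProduct.induction_on with
    | smul_tprod c v =>
      simp only [map_smul, bracket_tprod, coord_tprod]
      congr 1
      simp only [B, Module.Basis.coord_apply,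
        Basis.piTensorProduct_repr_tprod_apply, Pi.basisFun_repr]
      rw [← (blocks l h).prod_comp, Fintype.prod_sigma]
      simp only [hflat]
    | add y y' hy hy' => simp only [map_add, hy, hy']
  let unflat : (Fin d → Fin m) → (∀ i, Fin (l i) → Fin m) := fun j i q => j (blocks l h ⟨i, q⟩)
  have hfu : ∀ j, flat (unflat j) = j := fun j =>
    funext fun p => congrArg j ((blocks l h).apply_symm_apply p)
  have huf : ∀ J, unflat (flat J) = J := fun J =>
    funext fun i => funext fun q => hflat J ⟨i, q⟩
  refine ⟨fun x y hxy => coord_ext fun j => ?_, fun y => ?_⟩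
  · rw [← hfu j, ← hB, ← hB, hxy]
  · obtain ⟨x, hx⟩ := exists_coord (k := k) (fun j => B.coord (unflat j) y)
    refine ⟨x, B.ext_elem fun J => ?_⟩
    change B.coord J _ = B.coord J _
    rw [hB, hx, huf]

/-- By naturality of the bracketing, the projective case is a retract of the free one. -/
theorem bracket_bijective [Module.Finite k U] [Module.Projective k U] (l : Fin n → ℕ)
    (h : ∑ i, l i = d) : Function.Bijective (bracket k U l h) := by
  obtain ⟨m, p, hp⟩ := Module.Finite.exists_fin' k U
  obtain ⟨s, hs⟩ := Module.projective_lifting_property p LinearMap.id hp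
  have hps : ∀ {r : ℕ} (x : ⨂[k] (_ : Fin r), U),
      PiTensorProduct.map (fun _ => p) (PiTensorProduct.map (fun _ => s) x) = x := by
    intro r x
    rw [← LinearMap.comp_apply, ← PiTensorProduct.map_comp, hs, PiTensorProduct.map_id]
    rfl
  refine ⟨fun x y hxy => ?_, fun y => ?_⟩
  · rw [← hps x, ← hps y]
    congr 1
    apply (bracket_bijective_free k m l h).1
    rw [bracket_map, bracket_map, hxy]
  · obtain ⟨x, hx⟩ := (bracket_bijective_free k m l h).2
      (PiTensorProduct.map (fun i => PiTensorProduct.map (fun _ : Fin (l i) => s)) y)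
    refine ⟨PiTensorProduct.map (fun _ => p) x, ?_⟩
    rw [bracket_map, hx, ← LinearMap.comp_apply, ← PiTensorProduct.map_comp]
    have : (fun i => PiTensorProduct.map (fun _ : Fin (l i) => p) ∘ₗ
        PiTensorProduct.map (fun _ : Fin (l i) => s)) = fun _ => LinearMap.id :=
      funext fun i => LinearMap.ext hps
    rw [this, PiTensorProduct.map_id]
    rfl

end Bracket

/-! ### Sequences of given content -/

section Content

variable {n d : ℕ}

/-- The set of sequences `φ` in `{1, …, n}` of length `d` of content `l`, that is, such that
each `i` occurs `l i` times in `φ`. -/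
def contentSeqs (l : Fin n → ℕ) (d : ℕ) : Finset (Fin d → Fin n) :=
  {φ | ∀ i, Fintype.card {p // φ p = i} = l i}

theorem mem_contentSeqs {l : Fin n → ℕ} {φ : Fin d → Fin n} :
    φ ∈ contentSeqs l d ↔ ∀ i, Fintype.card {p // φ p = i} = l i := by
  simp [contentSeqs]

theorem eq_of_mem_contentSeqs {l l' : Fin n → ℕ} {φ : Fin d → Fin n}
    (h : φ ∈ contentSeqs l d) (h' : φ ∈ contentSeqs l' d) : l = l' :=
  funext fun i => (mem_contentSeqs.1 h i).symm.trans (mem_contentSeqs.1 h' i)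

theorem comp_mem_contentSeqs {l : Fin n → ℕ} {φ : Fin d → Fin n} (h : φ ∈ contentSeqs l d)
    (σ : Equiv.Perm (Fin d)) : φ ∘ σ ∈ contentSeqs l d := by
  rw [mem_contentSeqs] at h ⊢
  intro i
  rw [← h i]
  exact Fintype.card_congr (σ.subtypeEquiv fun _ => Iff.rfl)

theorem blockIndex_mem_contentSeqs (l : Fin n → ℕ) (h : ∑ i, l i = d) :
    blockIndex l h ∈ contentSeqs l d := by
  rw [mem_contentSeqs]
  intro i
  have e : {p // blockIndex l h p = i} ≃ Fin (l i) :=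
    ((blocks l h).symm.subtypeEquiv (q := fun q => q.1 = i) fun _ => Iff.rfl).trans
      (Equiv.sigmaSubtype i)
  rw [Fintype.card_congr e, Fintype.card_fin]

theorem exists_perm_of_mem_contentSeqs {l : Fin n → ℕ} (h : ∑ i, l i = d) {φ : Fin d → Fin n}
    (hφ : φ ∈ contentSeqs l d) : ∃ σ : Equiv.Perm (Fin d), ∀ p, φ (σ p) = blockIndex l h p := by
  rw [mem_contentSeqs] at hφ
  have e : ∀ i, Fin (l i) ≃ {p // φ p = i} := fun i =>
    Fintype.equivOfCardEq (by rw [hφ i, Fintype.card_fin])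
  refine ⟨(blocks l h).symm.trans ((Equiv.sigmaCongrRight e).trans (Equiv.sigmaFiberEquiv φ)),
    fun p => ?_⟩
  exact (e _ ((blocks l h).symm p).2).2

end Content

/-! ### Weight idempotents -/

section Weight

variable {k : Type u} [CommRing k] {n d : ℕ}

section Linear

variable {M V : Type u} [AddCommGroup M] [Module k M] [AddCommGroup V] [Module k V]

/-- The projection of a module with a finite basis onto the line spanned by the `i`-th basis
vector. -/
def lineProj (b : Module.Basis (Fin n) k M) (i : Fin n) : M →ₗ[k] M :=
  LinearMap.toSpanSingleton k M (b i) ∘ₗ b.coord i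

theorem coord_comp_toSpanSingleton (b : Module.Basis (Fin n) k M) (i j : Fin n) :
    b.coord i ∘ₗ LinearMap.toSpanSingleton k M (b j) = if i = j then LinearMap.id else 0 := by
  ext
  rw [LinearMap.comp_apply, LinearMap.toSpanSingleton_apply, one_smul, Module.Basis.coord_apply,
    Module.Basis.repr_self, Finsupp.single_apply]
  split_ifs with h h' h' <;> first | rfl | exact absurd h.symm h' | exact absurd h'.symm h

/-- The weight idempotent `e_λ ∈ Γ^d End(M)` for a module `M` with a basis: the sum of the tensors
`E_{φ(1)} ⊗ ⋯ ⊗ E_{φ(d)}` over all sequences `φ` of content `λ`, where `E_i` is the projection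
onto the `i`-th line. -/
def weightIdem (b : Module.Basis (Fin n) k M) (l : Fin n → ℕ) (d : ℕ) :
    SymTensor k d (M →ₗ[k] M) :=
  ⟨∑ φ ∈ contentSeqs l d, ⨂ₜ[k] p, lineProj b (φ p), fun σ => by
    rw [map_sum]
    simp only [permute_tprod]
    refine Finset.sum_nbij' (fun φ => φ ∘ σ.symm) (fun φ => φ ∘ σ)
      (fun φ hφ => comp_mem_contentSeqs hφ σ.symm) (fun φ hφ => comp_mem_contentSeqs hφ σ)
      ?_ ?_ (fun _ _ => rfl)
    · intro φ _
      funext p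
      simp
    · intro φ _
      funext p
      simp⟩

/-- The linear map `Γ^d Hom(M, V) → Γ^{λ₁} Hom(k, V) ⊗ ⋯ ⊗ Γ^{λₙ} Hom(k, V)` which comultiplies
and restricts the `i`-th factor to the `i`-th line. -/
def restrictLines [Module.Finite k (M →ₗ[k] V)] [Module.Projective k (M →ₗ[k] V)]
    (b : Module.Basis (Fin n) k M) (l : Fin n → ℕ) (h : ∑ i, l i = d) :
    SymTensor k d (M →ₗ[k] V) →ₗ[k] ⨂[k] i : Fin n, SymTensor k (l i) (k →ₗ[k] V) :=
  PiTensorProduct.map (fun i => SymTensor.map (l i)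
    (LinearMap.lcomp k V (LinearMap.toSpanSingleton k M (b i)))) ∘ₗ comul k (M →ₗ[k] V) l h

theorem inclSym_restrictLines [Module.Finite k (M →ₗ[k] V)] [Module.Projective k (M →ₗ[k] V)]
    (b : Module.Basis (Fin n) k M) (l : Fin n → ℕ) (h : ∑ i, l i = d)
    (f : SymTensor k d (M →ₗ[k] V)) :
    inclSym k (k →ₗ[k] V) l (restrictLines b l h f) =
      bracket k (k →ₗ[k] V) l h (PiTensorProduct.map
        (fun p => LinearMap.lcomp k V (LinearMap.toSpanSingleton k M (b (blockIndex l h p))))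
        f.1) := by
  rw [bracket_map_blockIndex l h
    (fun i => LinearMap.lcomp k V (LinearMap.toSpanSingleton k M (b i))), ← inclSym_comul,
    restrictLines, LinearMap.comp_apply, inclSym, inclSym]
  generalize comul k (M →ₗ[k] V) l h f = c
  rw [← LinearMap.comp_apply, ← LinearMap.comp_apply, ← PiTensorProduct.map_comp,
    ← PiTensorProduct.map_comp]
  rfl

/-- Composition with a pure tensor of linear maps is precomposition in each factor. -/
theorem map₂_compBilin_tprod {U : Type u} [AddCommGroup U] [Module k U] (e : Fin d → (U →ₗ[k] M))
    (x : ⨂[k] (_ : Fin d), (M →ₗ[k] V)) :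
    PiTensorProduct.map₂ (fun _ => compBilin k U M V) (⨂ₜ[k] p, e p) x =
      PiTensorProduct.map (fun p => LinearMap.lcomp k V (e p)) x := by
  induction x using PiTensorProduct.induction_on with
  | smul_tprod r f =>
    simp only [map_smul, PiTensorProduct.map₂_tprod_tprod, PiTensorProduct.map_tprod]
    rfl
  | add x y hx hy => simp only [map_add, hx, hy]

/-- The value of `f ∘ e_λ` as a tensor. -/
theorem weightIdem_comp_val (b : Module.Basis (Fin n) k M) (l : Fin n → ℕ)
    (f : SymTensor k d (M →ₗ[k] V)) :
    (SymTensor.map₂ d (compBilin k M M V) (weightIdem b l d) f).1 =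
      ∑ φ ∈ contentSeqs l d, PiTensorProduct.map
        (fun p => LinearMap.lcomp k V (lineProj b (φ p))) f.1 := by
  rw [SymTensor.map₂_val, weightIdem, map_sum, LinearMap.sum_apply]
  exact Finset.sum_congr rfl fun φ _ => map₂_compBilin_tprod _ _

/-- Precomposing with `E_{φ(1)} ⊗ ⋯ ⊗ E_{φ(d)}` is restricting to the corresponding lines and
extending back to `M`. -/
theorem map_lcomp_lineProj (b : Module.Basis (Fin n) k M) (φ : Fin d → Fin n)
    (x : ⨂[k] (_ : Fin d), (M →ₗ[k] V)) :
    PiTensorProduct.map (fun p => LinearMap.lcomp k V (lineProj b (φ p))) x =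
      PiTensorProduct.map (fun p => LinearMap.lcomp k V (b.coord (φ p)))
        (PiTensorProduct.map
          (fun p => LinearMap.lcomp k V (LinearMap.toSpanSingleton k M (b (φ p)))) x) := by
  rw [← LinearMap.comp_apply, ← PiTensorProduct.map_comp]
  rfl

/-- Extending along the coordinates `φ` and then restricting to the lines `ψ` is the identity if
`φ = ψ` and zero otherwise. -/
theorem map_lcomp_toSpanSingleton_coord (b : Module.Basis (Fin n) k M) (φ ψ : Fin d → Fin n)
    (x : ⨂[k] (_ : Fin d), (k →ₗ[k] V)) :
    PiTensorProduct.map (fun p => LinearMap.lcomp k V (LinearMap.toSpanSingleton k M (b (ψ p))))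
      (PiTensorProduct.map (fun p => LinearMap.lcomp k V (b.coord (φ p))) x) =
      if φ = ψ then x else 0 := by
  rw [← LinearMap.comp_apply, ← PiTensorProduct.map_comp]
  have hc : ∀ p, LinearMap.lcomp k V (LinearMap.toSpanSingleton k M (b (ψ p))) ∘ₗ
      LinearMap.lcomp k V (b.coord (φ p)) =
        if φ p = ψ p then (LinearMap.id : (k →ₗ[k] V) →ₗ[k] (k →ₗ[k] V)) else 0 := by
    intro p
    refine LinearMap.ext fun g => ?_
    change (g ∘ₗ b.coord (φ p)) ∘ₗ LinearMap.toSpanSingleton k M (b (ψ p)) = _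
    rw [LinearMap.comp_assoc, coord_comp_toSpanSingleton]
    split_ifs
    · rfl
    · exact LinearMap.comp_zero g
  simp only [hc]
  split_ifs with h
  · subst h
    simp only [if_true, PiTensorProduct.map_id]
    rfl
  · obtain ⟨p, hp⟩ := Function.ne_iff.1 h
    induction x using PiTensorProduct.induction_on with
    | smul_tprod r u =>
      rw [map_smul, PiTensorProduct.map_tprod, (PiTensorProduct.tprod k).map_coord_zero p,
        smul_zero]
      simp [hp]
    | add x y hx hy => rw [map_add, hx, hy, add_zero]

theorem map_lcomp_toSpanSingleton_lineProj (b : Module.Basis (Fin n) k M) (φ ψ : Fin d → Fin n)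
    (x : ⨂[k] (_ : Fin d), (M →ₗ[k] V)) :
    PiTensorProduct.map (fun p => LinearMap.lcomp k V (LinearMap.toSpanSingleton k M (b (ψ p))))
      (PiTensorProduct.map (fun p => LinearMap.lcomp k V (lineProj b (φ p))) x) =
      if φ = ψ then PiTensorProduct.map
        (fun p => LinearMap.lcomp k V (LinearMap.toSpanSingleton k M (b (ψ p)))) x else 0 := by
  rw [map_lcomp_lineProj, map_lcomp_toSpanSingleton_coord]
  split_ifs with h
  · rw [h]
  · rfl

variable [Module.Finite k (M →ₗ[k] V)] [Module.Projective k (M →ₗ[k] V)]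

variable [Module.Finite k (k →ₗ[k] V)] [Module.Projective k (k →ₗ[k] V)]

/-- On the left-hand side only the summand of `e_λ` at the block sequence of `λ'` survives the
restriction to the lines, and it occurs just when `λ = λ'`. -/
theorem restrictLines_weightIdem_comp (b : Module.Basis (Fin n) k M) (l l' : Fin n → ℕ)
    (h' : ∑ i, l' i = d) (f : SymTensor k d (M →ₗ[k] V)) :
    restrictLines b l' h' (SymTensor.map₂ d (compBilin k M M V) (weightIdem b l d) f) =
      if l = l' then restrictLines b l' h' f else 0 := by
  apply inclSym_injective
  rw [inclSym_restrictLines, weightIdem_comp_val, map_sum]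
  simp only [map_lcomp_toSpanSingleton_lineProj]
  rw [Finset.sum_ite_eq']
  by_cases hl : l = l'
  · subst hl
    rw [if_pos (blockIndex_mem_contentSeqs l h'), if_pos rfl, inclSym_restrictLines]
  · rw [if_neg hl, if_neg, map_zero, map_zero]
    exact fun hm => hl (eq_of_mem_contentSeqs hm (blockIndex_mem_contentSeqs l' h'))

/-- If `f` restricts to zero on the lines in block order then, by symmetry of `f`, it does so in
every order of content `λ`, so every summand of `f ∘ e_λ` vanishes. -/
theorem weightIdem_comp_eq_zero (b : Module.Basis (Fin n) k M) (l : Fin n → ℕ)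
    (h : ∑ i, l i = d) (f : SymTensor k d (M →ₗ[k] V)) (hf : restrictLines b l h f = 0) :
    SymTensor.map₂ d (compBilin k M M V) (weightIdem b l d) f = 0 := by
  have h₀ : PiTensorProduct.map (fun p => LinearMap.lcomp k V
      (LinearMap.toSpanSingleton k M (b (blockIndex l h p)))) f.1 = 0 := by
    apply (bracket_bijective l h).1
    rw [← inclSym_restrictLines, hf, map_zero, map_zero]
  apply Subtype.ext
  rw [weightIdem_comp_val]
  refine Finset.sum_eq_zero fun φ hφ => ?_
  -- the term at `φ` is a permutation of the one at the block sequence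
  obtain ⟨σ, hσ⟩ := exists_perm_of_mem_contentSeqs h hφ
  have hφσ : ∀ p, blockIndex l h (σ.symm p) = φ p := fun p => by
    rw [← hσ, Equiv.apply_symm_apply]
  have := congrArg (permute k _ σ) h₀
  rw [permute_map_family, map_zero, f.2 σ] at this
  simp only [hφσ] at this
  rw [map_lcomp_lineProj, this, map_zero]

/-- A preimage is the shuffle product: the concatenation of the given symmetric tensors, summed over
the rearrangements of its factors indexed by the sequences of content `λ`. -/
theorem restrictLines_surjective (b : Module.Basis (Fin n) k M) (l : Fin n → ℕ)
    (h : ∑ i, l i = d) : Function.Surjective (restrictLines (V := V) b l h) := by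
  intro y
  obtain ⟨t, ht⟩ := (bracket_bijective l h).2 (inclSym k (k →ₗ[k] V) l y)
  -- `t` is fixed by the Young subgroup, so `permute σ t` depends only on the coset of `σ`
  have hstab : ∀ σ τ : Equiv.Perm (Fin d),
      (∀ p, blockIndex l h (σ.symm p) = blockIndex l h (τ.symm p)) →
      permute k _ σ t = permute k _ τ t := by
    intro σ τ hστ
    have h₁ : permute k _ (τ⁻¹ * σ) t = t := by
      apply (bracket_bijective l h).1
      refine bracket_permute_of_inclSym l h _ (fun p => ?_) t y ht
      have := hστ (σ p)
      rw [Equiv.symm_apply_apply] at this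
      exact this.symm
    conv_rhs => rw [← h₁]
    rw [← permute_mul, mul_inv_cancel_left]
  have hperm : ∀ φ : Fin d → Fin n, ∃ σ : Equiv.Perm (Fin d), φ ∈ contentSeqs l d →
      ∀ p, blockIndex l h (σ.symm p) = φ p := by
    intro φ
    by_cases hφ : φ ∈ contentSeqs l d
    · obtain ⟨σ, hσ⟩ := exists_perm_of_mem_contentSeqs h hφ
      exact ⟨σ, fun _ p => by rw [← hσ, Equiv.apply_symm_apply]⟩
    · exact ⟨1, fun h => absurd h hφ⟩
  choose s hs using hperm
  -- the symmetrization of `t` over the cosets of the Young subgroup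
  let f : SymTensor k d (M →ₗ[k] V) :=
    ⟨∑ φ ∈ contentSeqs l d, PiTensorProduct.map (fun p => LinearMap.lcomp k V (b.coord (φ p)))
      (permute k _ (s φ) t), fun σ => by
        rw [map_sum]
        refine Finset.sum_nbij' (fun φ => φ ∘ σ.symm) (fun φ => φ ∘ σ)
          (fun φ hφ => comp_mem_contentSeqs hφ σ.symm) (fun φ hφ => comp_mem_contentSeqs hφ σ)
          ?_ ?_ ?_
        · intro φ _
          funext p
          simp
        · intro φ _
          funext p
          simp
        · intro φ hφ
          rw [permute_map_family, ← permute_mul]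
          refine congrArg _ (hstab _ _ fun p => ?_)
          rw [hs _ (comp_mem_contentSeqs hφ σ.symm)]
          exact hs φ hφ (σ.symm p)⟩
  refine ⟨f, ?_⟩
  apply inclSym_injective
  rw [inclSym_restrictLines, map_sum]
  simp only [map_lcomp_toSpanSingleton_coord]
  have hb := blockIndex_mem_contentSeqs l h
  rw [Finset.sum_ite_eq', if_pos hb, ← ht,
    hstab (s (blockIndex l h)) 1 (fun p => hs _ hb p)]
  rw [permute_one]

end Linear

end Weight

/-! ### `Γ^λ` as a retract of a representable functor -/

section Retract

variable {k : Type u} [CommRing k] {n d : ℕ}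

instance (V : ProjMod k) : Module.Finite k (k →ₗ[k] V) :=
  Module.Finite.equiv (LinearMap.ringLmapEquivSelf k k V).symm

instance (V : ProjMod k) : Module.Projective k (k →ₗ[k] V) :=
  Module.Projective.of_equiv (LinearMap.ringLmapEquivSelf k k V).symm

variable {M : ProjMod k} (b : Module.Basis (Fin n) k M) (lam : Compositions n d)

/-- The value of `Γ^λ(f)` at the element `e₁^{⊗ λ₁} ⊗ ⋯ ⊗ eₙ^{⊗ λₙ}` of `Γ^λ(M)`. -/
theorem externalMap_pow (V : ProjMod k) (f : SymTensor k d (M →ₗ[k] V)) :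
    externalMap lam.2 (fun i => (represent k (lam.1 i)).obj (op (DivPow.unit k (lam.1 i)))) M V f
      (⨂ₜ[k] i, SymTensor.pow (lam.1 i) (LinearMap.toSpanSingleton k M (b i))) =
    restrictLines b lam.1 lam.2 f := by
  rw [externalMap, restrictLines, LinearMap.comp_apply, LinearMap.comp_apply,
    LinearMap.comp_apply]
  generalize comul k (M →ₗ[k] V) lam.1 lam.2 f = c
  induction c using PiTensorProduct.induction_on with
  | smul_tprod r c =>
    simp only [map_smul, LinearMap.smul_apply, PiTensorProduct.map_tprod]
    refine congrArg (r • ·) ((PiTensorProduct.piTensorHomMap_tprod_tprod _ _).trans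
      (congrArg (PiTensorProduct.tprod k) (funext fun i => Subtype.ext ?_)))
    exact map₂_compBilin_tprod (fun _ => LinearMap.toSpanSingleton k M (b i)) (c i).1
  | add x y hx hy =>
    rw [map_add, map_add, map_add, ← hx, ← hy]
    rfl

/-- The morphism `Γ^{d,M} ⟶ Γ^λ` which corresponds under the Yoneda lemma to the element
`e₁^{⊗ λ₁} ⊗ ⋯ ⊗ eₙ^{⊗ λₙ}` for the given basis of `M`. -/
def weightProj : (represent k d).obj (op ⟨M⟩) ⟶ divPowFunctor k lam :=
  ObjectProperty.homMk
    { app := fun V => ModuleCat.ofHom (restrictLines b lam.1 lam.2 (V := V.mod))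
      naturality := fun V W g => ModuleCat.hom_ext (LinearMap.ext fun f =>
        (externalMap_pow b lam W.mod _).symm.trans
          ((LinearMap.congr_fun (externalMap_comp lam.2 _ M V.mod W.mod f g) _).trans
            (congrArg (externalMap lam.2 _ V.mod W.mod g) (externalMap_pow b lam V.mod f)))) }

/-- The weight idempotent as an endomorphism in `Γ^d P_k`. -/
def weightEnd (l : Fin n → ℕ) : (⟨M⟩ : DivPow k d) ⟶ ⟨M⟩ := weightIdem b l d

/-- Orthogonality of the weight idempotents, in terms of the projections onto the functors
`Γ^λ`. -/
theorem represent_map_weightEnd_comp_weightProj (l : Fin n → ℕ) :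
    (represent k d).map (weightEnd b l).op ≫ weightProj b lam =
      if l = lam.1 then weightProj b lam else 0 := by
  refine ObjectProperty.hom_ext _ (NatTrans.ext (funext fun V => ModuleCat.hom_ext
    (LinearMap.ext fun f => ?_)))
  refine (restrictLines_weightIdem_comp b l lam.1 lam.2 f).trans ?_
  split_ifs <;> rfl

/-- A pointwise surjective `p : P ⟶ X` exhibits `X` as the summand of `P` cut out by `e`, provided
that `e ≫ p = p` and `e` vanishes on the kernel of `p`: then `e` factors through `p`. -/
theorem StrictPoly.exists_retract {P X : StrictPoly k d} (p : P ⟶ X) (e : P ⟶ P)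
    (hp : ∀ V, Function.Surjective (p.hom.app V).hom) (hep : e ≫ p = p)
    (hker : ∀ V f, (p.hom.app V).hom f = 0 → (e.hom.app V).hom f = 0) :
    ∃ R : Retract X P, R.r = p ∧ R.r ≫ R.i = e := by
  have hfac : ∀ V, ∃ i : X.obj.obj V ⟶ P.obj.obj V, p.hom.app V ≫ i = e.hom.app V := fun V => by
    let q := (LinearMap.ker (p.hom.app V).hom).liftQ (e.hom.app V).hom (fun f hf => hker V f hf)
    let E := (p.hom.app V).hom.quotKerEquivOfSurjective (hp V)
    refine ⟨ModuleCat.ofHom (q ∘ₗ E.symm.toLinearMap),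
      ModuleCat.hom_ext (LinearMap.ext fun f => ?_)⟩
    exact congrArg q (E.symm_apply_eq.2 rfl : E.symm ((p.hom.app V).hom f) =
      Submodule.Quotient.mk f)
  choose i hi using hfac
  have hepi : ∀ V, Epi (p.hom.app V) := fun V => (ModuleCat.epi_iff_surjective _).2 (hp V)
  let ι : X ⟶ P := ObjectProperty.homMk
    { app := i
      naturality := fun V W g => by
        have := hepi V
        rw [← cancel_epi (p.hom.app V), ← Category.assoc, ← p.hom.naturality, Category.assoc, hi,
          ← Category.assoc, hi, e.hom.naturality] }
  have hι : p ≫ ι = e := ObjectProperty.hom_ext _ (NatTrans.ext (funext hi))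
  have hι' : ι ≫ p = 𝟙 X := by
    refine ObjectProperty.hom_ext _ (NatTrans.ext (funext fun V => ?_))
    have := hepi V
    rw [← cancel_epi (p.hom.app V)]
    have h : p ≫ ι ≫ p = p ≫ 𝟙 X := by rw [← Category.assoc, hι, hep, Category.comp_id]
    exact NatTrans.congr_app (congrArg (fun q => q.hom) h) V
  exact ⟨⟨ι, p, hι'⟩, rfl, hι⟩

/-- `Γ^λ` is the direct summand of `Γ^{d,M}` cut out by the weight idempotent `e_λ`. -/
theorem exists_retract_divPowFunctor :
    ∃ R : Retract (divPowFunctor k lam) ((represent k d).obj (op ⟨M⟩)),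
      R.r = weightProj b lam ∧ R.r ≫ R.i = (represent k d).map (weightEnd b lam.1).op :=
  StrictPoly.exists_retract _ _ (fun _ => restrictLines_surjective b lam.1 lam.2)
    ((represent_map_weightEnd_comp_weightProj b lam lam.1).trans (if_pos rfl))
    (fun _ f hf => weightIdem_comp_eq_zero b lam.1 lam.2 f hf)

end Retract

/-! ### Tensor products of weight idempotents -/

section Tensor

variable {m n d : ℕ}

/-- The pairing of two sequences, with pairs ordered row by row. -/
def pairSeq (φ : Fin d → Fin m) (ψ : Fin d → Fin n) (p : Fin d) : Fin (m * n) :=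
  finProdFinEquiv (φ p, ψ p)

theorem exists_eq_pairSeq (χ : Fin d → Fin (m * n)) :
    ∃ (φ : Fin d → Fin m) (ψ : Fin d → Fin n), χ = pairSeq φ ψ :=
  ⟨fun p => (finProdFinEquiv.symm (χ p)).1, fun p => (finProdFinEquiv.symm (χ p)).2,
    funext fun p => (finProdFinEquiv.apply_symm_apply (χ p)).symm⟩

theorem sum_card_fiber_fst (φ : Fin d → Fin m) (ψ : Fin d → Fin n) (i : Fin m) :
    ∑ j, Fintype.card {p // φ p = i ∧ ψ p = j} = Fintype.card {p // φ p = i} := by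
  rw [← Fintype.card_sigma]
  exact Fintype.card_congr
    ((Equiv.sigmaCongrRight fun j => (Equiv.subtypeSubtypeEquivSubtypeInter _ _).symm).trans
      (Equiv.sigmaFiberEquiv fun p : {p // φ p = i} => ψ p))

theorem sum_card_fiber_snd (φ : Fin d → Fin m) (ψ : Fin d → Fin n) (j : Fin n) :
    ∑ i, Fintype.card {p // φ p = i ∧ ψ p = j} = Fintype.card {p // ψ p = j} := by
  rw [← sum_card_fiber_fst ψ φ j]
  exact Finset.sum_congr rfl fun i _ =>
    Fintype.card_congr (Equiv.subtypeEquivRight fun _ => and_comm)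

variable {lam : Compositions m d} {mu : Compositions n d}

theorem toComposition_apply (A : MarginMatrices lam mu) (i : Fin m) (j : Fin n) :
    A.toComposition.1 (finProdFinEquiv (i, j)) = A.1 i j := by
  simp only [MarginMatrices.toComposition, Equiv.symm_apply_apply]

theorem pairSeq_mem_contentSeqs (A : MarginMatrices lam mu) (φ : Fin d → Fin m)
    (ψ : Fin d → Fin n) : pairSeq φ ψ ∈ contentSeqs A.toComposition.1 d ↔
      ∀ i j, Fintype.card {p // φ p = i ∧ ψ p = j} = A.1 i j := by
  have hc : ∀ i j, Fintype.card {p // pairSeq φ ψ p = finProdFinEquiv (i, j)} =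
      Fintype.card {p // φ p = i ∧ ψ p = j} := fun i j =>
    Fintype.card_congr (Equiv.subtypeEquivRight fun p => by simp [pairSeq])
  rw [mem_contentSeqs, ← finProdFinEquiv.forall_congr_right, Prod.forall]
  refine forall₂_congr fun i j => ?_
  rw [hc, toComposition_apply]

theorem toComposition_injective :
    Function.Injective fun A : MarginMatrices lam mu => A.toComposition.1 := by
  intro A B h
  apply Subtype.ext
  funext i j
  rw [← toComposition_apply, ← toComposition_apply]
  exact congrFun h _

/-- The pairs of a sequence of content `λ` and a sequence of content `μ` are the sequences whose
content is a matrix with row sums `λ` and column sums `μ`. -/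
theorem sum_contentSeqs_pairSeq {G : Type*} [AddCommMonoid G] [Fintype (MarginMatrices lam mu)]
    (F : (Fin d → Fin (m * n)) → G) :
    ∑ φ ∈ contentSeqs lam.1 d, ∑ ψ ∈ contentSeqs mu.1 d, F (pairSeq φ ψ) =
      ∑ A : MarginMatrices lam mu, ∑ χ ∈ contentSeqs A.toComposition.1 d, F χ := by
  rw [← Finset.sum_product', Finset.sum_sigma']
  symm
  refine Finset.sum_bij (fun x _ => (fun p => (finProdFinEquiv.symm (x.2 p)).1,
    fun p => (finProdFinEquiv.symm (x.2 p)).2)) ?_ ?_ ?_ ?_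
  · rintro ⟨A, χ⟩ h
    obtain ⟨φ, ψ, rfl⟩ := exists_eq_pairSeq χ
    have hA := (pairSeq_mem_contentSeqs A φ ψ).1 (Finset.mem_sigma.1 h).2
    simp only [pairSeq, Equiv.symm_apply_apply]
    refine Finset.mem_product.2 ⟨mem_contentSeqs.2 fun i => ?_, mem_contentSeqs.2 fun j => ?_⟩
    · rw [← A.2.1 i, ← sum_card_fiber_fst φ ψ]
      exact Finset.sum_congr rfl fun j _ => hA i j
    · rw [← A.2.2 j, ← sum_card_fiber_snd φ ψ]
      exact Finset.sum_congr rfl fun i _ => hA i j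
  · rintro ⟨A, χ⟩ h ⟨A', χ'⟩ h' hχ
    obtain ⟨φ, ψ, rfl⟩ := exists_eq_pairSeq χ
    obtain ⟨φ', ψ', rfl⟩ := exists_eq_pairSeq χ'
    simp only [pairSeq, Equiv.symm_apply_apply, Prod.mk.injEq] at hχ
    obtain rfl : φ = φ' := hχ.1
    obtain rfl : ψ = ψ' := hχ.2
    obtain rfl := toComposition_injective
      (eq_of_mem_contentSeqs (Finset.mem_sigma.1 h).2 (Finset.mem_sigma.1 h').2)
    rfl
  · rintro ⟨φ, ψ⟩ h
    obtain ⟨hφ, hψ⟩ := Finset.mem_product.1 h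
    refine ⟨⟨⟨fun i j => Fintype.card {p // φ p = i ∧ ψ p = j}, fun i => ?_, fun j => ?_⟩,
      pairSeq φ ψ⟩, Finset.mem_sigma.2 ⟨Finset.mem_univ _, ?_⟩, ?_⟩
    · rw [sum_card_fiber_fst, mem_contentSeqs.1 hφ]
    · rw [sum_card_fiber_snd, mem_contentSeqs.1 hψ]
    · rw [pairSeq_mem_contentSeqs]
      exact fun _ _ => rfl
    · simp [pairSeq]
  · rintro ⟨A, χ⟩ _
    exact congrArg F (funext fun p => (finProdFinEquiv.apply_symm_apply (χ p)).symm)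

variable {k : Type u} [CommRing k] {M N : ProjMod k}

/-- The basis of a tensor product consisting of the products of basis vectors, ordered row by
row. -/
abbrev prodBasis (b : Module.Basis (Fin m) k M) (c : Module.Basis (Fin n) k N) :
    Module.Basis (Fin (m * n)) k (M ⊗[k] N) :=
  (b.tensorProduct c).reindex finProdFinEquiv

theorem map_lineProj (b : Module.Basis (Fin m) k M) (c : Module.Basis (Fin n) k N)
    (i : Fin m) (j : Fin n) :
    TensorProduct.map (lineProj b i) (lineProj c j) =
      lineProj (prodBasis b c) (finProdFinEquiv (i, j)) := by
  refine TensorProduct.ext' fun x y => ?_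
  simp [lineProj, ← TensorProduct.smul_tmul', smul_smul, mul_comm]

/-- The tensor product of the weight idempotents of `λ` and `μ` is the sum of the weight idempotents
of the matrices with row sums `λ` and column sums `μ`. -/
theorem tensorHom_weightEnd [Fintype (MarginMatrices lam mu)] (b : Module.Basis (Fin m) k M)
    (c : Module.Basis (Fin n) k N) :
    DivPow.tensorHom (weightEnd (d := d) b lam.1) (weightEnd c mu.1) =
      ∑ A : MarginMatrices lam mu,
        weightEnd (d := d) (M := ⟨M ⊗[k] N⟩) (prodBasis b c) A.toComposition.1 := by
  apply Subtype.ext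
  have hval : ∀ f : MarginMatrices lam mu → SymTensor k d ((M ⊗[k] N) →ₗ[k] (M ⊗[k] N)),
      (∑ A, f A).1 = ∑ A, (f A).1 := fun f => map_sum (SymTensor k d _).subtype f _
  refine Eq.trans ?_ (hval fun A => weightIdem (prodBasis b c) A.toComposition.1 d).symm
  refine Eq.trans ?_ (sum_contentSeqs_pairSeq fun χ =>
    ⨂ₜ[k] p, lineProj (prodBasis b c) (χ p))
  change PiTensorProduct.map₂ _ (∑ φ ∈ _, ⨂ₜ[k] p, _) (∑ ψ ∈ _, ⨂ₜ[k] p, _) = _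
  rw [LinearMap.map_sum₂]
  refine Finset.sum_congr rfl fun φ _ => ?_
  rw [map_sum]
  refine Finset.sum_congr rfl fun ψ _ => ?_
  rw [PiTensorProduct.map₂_tprod_tprod]
  exact congrArg (PiTensorProduct.tprod k) (funext fun p => map_lineProj b c (φ p) (ψ p))

end Tensor

end StrictPolynomial

end

theorem mainTheorem2 (k : Type u) [CommRing k] {m n d : ℕ}
    (lam : StrictPolynomial.Compositions m d) (mu : StrictPolynomial.Compositions n d) :
    Nonempty (StrictPolynomial.internalTensor (StrictPolynomial.divPowFunctor k lam)
        (StrictPolynomial.divPowFunctor k mu) ≅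
      ⨁ fun A : StrictPolynomial.MarginMatrices lam mu =>
        StrictPolynomial.divPowFunctor k A.toComposition) := by
  classical
  let _ : Fintype (StrictPolynomial.MarginMatrices lam mu) := Fintype.ofFinite _
  let M : StrictPolynomial.ProjMod k := ⟨Fin m → k⟩
  let N : StrictPolynomial.ProjMod k := ⟨Fin n → k⟩
  let b : Module.Basis (Fin m) k M := Pi.basisFun k (Fin m)
  let c : Module.Basis (Fin n) k N := Pi.basisFun k (Fin n)
  obtain ⟨R, -, hR⟩ := StrictPolynomial.exists_retract_divPowFunctor b lam
  obtain ⟨S, -, hS⟩ := StrictPolynomial.exists_retract_divPowFunctor c mu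
  obtain ⟨L, hL⟩ := StrictPolynomial.exists_retract_internalTensor R S hR hS
  choose K hK hK' using fun A : StrictPolynomial.MarginMatrices lam mu =>
    StrictPolynomial.exists_retract_divPowFunctor (M := ⟨M ⊗[k] N⟩)
      (StrictPolynomial.prodBasis b c) A.toComposition
  refine L.nonempty_iso_biproduct K (fun A B hAB => ?_) ?_
  · -- `i_A ≫ p_B = i_A ≫ e_A ≫ p_B`, and `e_A ≫ p_B = 0`
    have h := StrictPolynomial.represent_map_weightEnd_comp_weightProj
      (M := ⟨M ⊗[k] N⟩) (StrictPolynomial.prodBasis b c) B.toComposition A.toComposition.1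
    rw [if_neg fun h' => hAB (StrictPolynomial.toComposition_injective h'), ← hK' A, ← hK B] at h
    have h' := congrArg (fun q => (K A).i ≫ q) h
    rw [Category.assoc, ← Category.assoc, (K A).retract, Category.id_comp] at h'
    exact h'.trans comp_zero
  · rw [hL, StrictPolynomial.tensorHom_weightEnd]
    refine (StrictPolynomial.represent_map_sum _).trans ?_
    exact Finset.sum_congr rfl fun A _ => (hK' A).symm
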